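/- **Setting.** Let $M\in\mathbb N$, let $\mathcal Z$ be a finite set, and for each hypothesis $m\in[M]=\{0,\dots,M-1\}$ let $\alpha_m(\cdot\mid\cdot)$ be a transition kernel on $\mathcal Z$, $\eta_m$ an initial probability law on $\mathcal Z$, and $\pi_m>0$ a prior probability, $\sum_m\pi_m=1$. Observations $Z_1,Z_2,\dots\in\mathcal Z$ are distributed over disjoint paths: each index $\ell$ is assigned (deterministically) to a path. The ancestor $\mathcal A_\ell$ of $Z_\ell$ is the most recent earlier observation on the same path; there is none if $Z_\ell$ is the first on its path. Under hypothesis $m$, the law of the observations is $$f_m(z_1^n)=\mathbb P(Z_1^n=z_1^n\mid\mathcal H_m)=\prod_{i=1}^n\alpha_m(z_i\mid\mathcal A_i),$$ where the factor is read as $\eta_m(z_i)$ if $z_i$ is the first observation on its path. Assume that the paths are long on average: the number of distinct paths among the first $n$ observations is $o(n)$. For $a\in[0,1)^M$ let $$T_{\rm MSPRT}=\inf\Big\{n\ge1:\ \frac{\pi_m f_m(Z_1^n)}{\sum_{j}\pi_jf_j(Z_1^n)}\ge\frac1{1+a_m}\ \text{for some } m\in[M]\Big\}\in\mathbb N\cup\{\infty\}.$$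 For probability vectors $p,q$ on $\mathcal Z$ put $d_{\rm KL}(p\|q)=\sum_zp(z)\log\frac{p(z)}{q(z)}\in[0,\infty]$, $\chi^2(p,q)=\sum_z\frac{p(z)^2}{q(z)}-1\in[0,\infty]$ (terms with $p(z)=0$ are $0$; other terms with $q(z)=0$ are $\infty$), and $S_{k,j}(z)=\sum_{z'}\sqrt{\alpha_k(z'\mid z)\alpha_j(z'\mid z)}$. If $\alpha_k$ is irreducible with stationary law $\pi_k^{\rm stat}$, put $$d_{\rm KL}(\alpha_k\|\alpha_j\mid\pi_k^{\rm stat})=\sum_{z}\pi_k^{\rm stat}(z)\,d_{\rm KL}\big(\alpha_k(\cdot\mid z)\,\|\,\alpha_j(\cdot\mid z)\big).$$ **Theorem.** Fix $k\in[M]$ and assume that $\alpha_k$ is irreducible, that $$\min_{j\ne k}\max_{z}\chi^2\big(\alpha_k(\cdot\mid z),\alpha_j(\cdot\mid z)\big)<\infty\quad\text{and}\quad\min_{j\ne k}\max_zS_{k,j}(z)<1$$ (a minimum over the empty set is $+\infty$, so $M\ge2$), and that $\chi^2(\eta_k,\eta_j)<\infty$ for every $j\ne k$ with $\max_z\chi^2(\alpha_k(\cdot\mid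 z),\alpha_j(\cdot\mid z))<\infty$. Then, as $\|a\|_\infty=\max_m|a_m|\to0$ within $\{a\in[0,1)^M: a_k>0\}$, $$\frac{T_{\rm MSPRT}}{-\log a_k}\longrightarrow\frac1{\min_{j\neq k}d_{\rm KL}(\alpha_k\|\alpha_j\mid\pi_k^{\rm stat})}\qquad f_k\text{-almost surely},$$ and $$\frac{\mathbb E_k[T_{\rm MSPRT}]}{-\log a_k}\longrightarrow\frac1{\min_{j\neq k}d_{\rm KL}(\alpha_k\|\alpha_j\mid\pi_k^{\rm stat})},$$ where $\mathbb E_k$ is expectation under hypothesis $k$ and both limits are taken in $[0,\infty]$ with $1/0=\infty$. -/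

import Mathlib

open MeasureTheory Filter Topology
open scoped ENNReal

namespace MSPRT

variable {Z ι : Type*}

/-- The index of the observation preceding observation `i` on its own path (`path i` is the path
to which observation `i` belongs), or `none` if observation `i` is the first one on its path.
Observations are numbered from `0`. -/
def ancestor [DecidableEq ι] (path : ℕ → ι) (i : ℕ) : Option ℕ :=
  if h : ((Finset.range i).filter (fun j => path j = path i)).Nonempty then
    some (((Finset.range i).filter (fun j => path j = path i)).max' h)
  else none

/-- Probability of observation `i` of `z` given the past: initial law `η` for the first edge of a
path, transition probability `α` from its ancestor otherwise.  Here `α z z'` is `α(z' ∣ z)`. -/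
noncomputable def stepProb [DecidableEq ι] (α : Z → PMF Z) (η : PMF Z) (path : ℕ → ι)
    (z : ℕ → Z) (i : ℕ) : ℝ≥0∞ :=
  match ancestor path i with
  | none => η (z i)
  | some j => α (z j) (z i)

/-- The likelihood `f(z_1^n)` of the first `n` observations. -/
noncomputable def likelihood [DecidableEq ι] (α : Z → PMF Z) (η : PMF Z) (path : ℕ → ι)
    (z : ℕ → Z) (n : ℕ) : ℝ≥0∞ :=
  ∏ i ∈ Finset.range n, stepProb α η path z i

/-- Under `P`, the observations `X 0, X 1, …` form a union of disjoint Markov chains (one for each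
path) with transition kernel `α` and initial law `η`. -/
structure IsEdgeProcess [DecidableEq ι] [MeasurableSpace Z] {Ω : Type*} [MeasurableSpace Ω]
    (P : Measure Ω) (X : ℕ → Ω → Z) (α : Z → PMF Z) (η : PMF Z) (path : ℕ → ι) : Prop where
  measurable : ∀ i, Measurable (X i)
  law : ∀ (n : ℕ) (z : ℕ → Z),
    P {ω | ∀ i < n, X i ω = z i} = likelihood α η path z n

/-- Posterior probability of hypothesis `m` after the first `n` observations of `z`. -/
noncomputable def posterior [DecidableEq ι] {M : ℕ} (prior : PMF (Fin M))
    (α : Fin M → Z → PMF Z) (η : Fin M → PMF Z) (path : ℕ → ι) (z : ℕ → Z) (n : ℕ)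
    (m : Fin M) : ℝ≥0∞ :=
  prior m * likelihood (α m) (η m) path z n /
    ∑ j, prior j * likelihood (α j) (η j) path z n

/-- The MSPRT stopping time: the first `n ≥ 1` at which some posterior probability
reaches its threshold `1 / (1 + a m)` (and `∞` if there is none). -/
noncomputable def stoppingTime [DecidableEq ι] {M : ℕ} (prior : PMF (Fin M))
    (α : Fin M → Z → PMF Z) (η : Fin M → PMF Z) (path : ℕ → ι) (a : Fin M → ℝ)
    (z : ℕ → Z) : ℕ∞ :=
  sInf {t : ℕ∞ | ∃ n : ℕ, t = n ∧ 1 ≤ n ∧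
    ∃ m, ENNReal.ofReal (1 / (1 + a m)) ≤ posterior prior α η path z n m}

/-- Irreducibility of a transition kernel. -/
def IrreducibleKernel (α : Z → PMF Z) : Prop :=
  ∀ z z', Relation.ReflTransGen (fun x y => 0 < α x y) z z'

/-- The `χ²`-divergence `∑ p² / q - 1`, with values in `[0, ∞]`. -/
noncomputable def chiSq [Fintype Z] (p q : PMF Z) : ℝ≥0∞ :=
  (∑ z, p z ^ 2 / q z) - 1

/-- The Hellinger affinity `∑ √(p q)`. -/
noncomputable def affinity [Fintype Z] (p q : PMF Z) : ℝ≥0∞ :=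
  ∑ z, (p z * q z) ^ (1 / 2 : ℝ)

/-- The conditional Kullback-Leibler divergence of `α` from `β` given the law `ρ`. -/
noncomputable def condKL [Fintype Z] [MeasurableSpace Z] (α β : Z → PMF Z) (ρ : PMF Z) : ℝ≥0∞ :=
  ∑ z, ρ z * InformationTheory.klDiv (α z).toMeasure (β z).toMeasure

end MSPRT

/-!
Under hypothesis `k`, write `f_j` for the likelihood of hypothesis `j` and `n` for the number of
observations. For small thresholds the test stops when all the other weighted likelihoods have
fallen below `a k` times that of `k`, so everything rests on the exponential rate at which `f_j / f_k`
decays, which is the conditional Kullback-Leibler divergence `D_j`.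

*Rates.* Up to a bounded contribution of the first observation of each path, `log (f_k / f_j)` is a
sum along the paths of a function `g` of the ancestor and the current value (`pathSum`). Solving the
Poisson equation of the irreducible kernel (`IrreducibleKernel.exists_sub_kernelOp_eq`) writes `g` as
its stationary mean, plus a function centred given the ancestor, plus a difference `u y - u x`. The
last part telescopes along each path (`pathSum_sub_le`) and is bounded by a multiple of the number of
paths, which is `o(n)`; the centred part obeys a Chernoff bound. Hence a deviation of the sum from
its drift by a multiple of `n` has summable probability
(`IsEdgeProcess.tsum_measure_le_pathSum_ne_top`). When `D_j` is infinite, the log-likelihood ratio is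
replaced by a minorant with a drift as large as needed (`exists_le_drift`).

*Changes of measure.* The Chernoff bound and Ville's inequality for `f_j / f_k` are both instances of
`IsEdgeProcess.measure_le_of_likelihood_le`: an event on which the likelihood is at most `ε` times a
product of sub-probability weights has probability at most `ε`. The Chernoff bound uses tilted
transition probabilities; Ville's inequality uses those of `j` up to the crossing time and those of
`k` afterwards.

*Upper bound.* For `q` below every `D_j`, the stopping time is at most `-log (a k) / q + C` plus the
number of exceptional times at which some `f_j / f_k` exceeds `exp (-n q)`. This number is integrable,
so the one inequality `exists_stoppingTime_le` serves both the almost sure limit and the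
expectation.

*Lower bound.* Ville's inequality rules out a decision against `k` once the thresholds are small, and
a decision for `k` needs `f_j` to fall below a multiple of `a k * f_k` for the `j` of least
divergence (`exists_eventually_le_stoppingTime`). This gives the almost sure lower bound, and Fatou's
lemma transfers it to the expectation.
-/

namespace MSPRT

section

variable {Z ι : Type*} [DecidableEq ι] {path : ℕ → ι}

/-! ### Ancestors and likelihoods -/

lemma ancestor_eq_none_iff {i : ℕ} :
    ancestor path i = none ↔ ∀ j < i, path j ≠ path i := by
  unfold ancestor
  split_ifs with h
  · obtain ⟨j, hj⟩ := h
    simp only [Finset.mem_filter, Finset.mem_range] at hj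
    simp only [false_iff, not_forall]
    exact ⟨j, hj.1, fun hne => hne hj.2⟩
  · simp only [true_iff]
    intro j hj hp
    exact h ⟨j, by simp [hj, hp]⟩

lemma ancestor_eq_some {i j : ℕ} (h : ancestor path i = some j) :
    j < i ∧ path j = path i ∧ ∀ l < i, path l = path i → l ≤ j := by
  unfold ancestor at h
  split_ifs at h with hne
  have hj := Finset.max'_mem _ hne
  rw [Option.some.inj h] at hj
  simp only [Finset.mem_filter, Finset.mem_range] at hj
  refine ⟨hj.1, hj.2, fun l hl hp => ?_⟩
  rw [← Option.some.inj h]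
  exact Finset.le_max' _ _ (by simp [hl, hp])

/-- Distinct observations have distinct ancestors: a path does not branch. -/
lemma ancestor_injective {i i' j : ℕ} (h : ancestor path i = some j)
    (h' : ancestor path i' = some j) : i = i' := by
  obtain ⟨h1, h2, h3⟩ := ancestor_eq_some h
  obtain ⟨h1', h2', h3'⟩ := ancestor_eq_some h'
  rcases lt_trichotomy i i' with hlt | heq | hgt
  · have := h3' i hlt (h2.symm.trans h2')
    omega
  · exact heq
  · have := h3 i' hgt (h2'.symm.trans h2)
    omega

lemma stepProb_congr {α : Z → PMF Z} {η : PMF Z} {z z' : ℕ → Z} {i : ℕ}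
    (h : ∀ j ≤ i, z j = z' j) : stepProb α η path z i = stepProb α η path z' i := by
  unfold stepProb
  rcases hA : ancestor path i with _ | j
  · simp [h i le_rfl]
  · simp [h i le_rfl, h j (ancestor_eq_some hA).1.le]

lemma likelihood_congr {α : Z → PMF Z} {η : PMF Z} {z z' : ℕ → Z} {n : ℕ}
    (h : ∀ j < n, z j = z' j) : likelihood α η path z n = likelihood α η path z' n :=
  Finset.prod_congr rfl fun _ hi =>
    stepProb_congr fun j hj => h j (hj.trans_lt (Finset.mem_range.mp hi))

lemma likelihood_succ (α : Z → PMF Z) (η : PMF Z) (z : ℕ → Z) (n : ℕ) :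
    likelihood α η path z (n + 1) = likelihood α η path z n * stepProb α η path z n :=
  Finset.prod_range_succ _ _

lemma stepProb_le_one (α : Z → PMF Z) (η : PMF Z) (z : ℕ → Z) (i : ℕ) :
    stepProb α η path z i ≤ 1 := by
  unfold stepProb
  split <;> exact PMF.coe_le_one _ _

lemma likelihood_ne_top (α : Z → PMF Z) (η : PMF Z) (z : ℕ → Z) (n : ℕ) :
    likelihood α η path z n ≠ ∞ :=
  ne_top_of_le_ne_top ENNReal.one_ne_top
    (Finset.prod_le_one' fun i _ => stepProb_le_one α η z i)

variable [Fintype Z]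

lemma sum_pmf (p : PMF Z) : ∑ x, p x = 1 := by
  simpa using p.tsum_coe

/-- If a weight `w` depends only on the value of the ancestor and on the current value, its
conditional mean given the past is bounded by bounding its mean under the initial law and under
each transition law. -/
lemma sum_stepProb_mul_le (α : Z → PMF Z) (η : PMF Z) (z : ℕ → Z) (i : ℕ)
    (w : Option Z → Z → ℝ≥0∞) {b : ℝ≥0∞} (h0 : ∑ x, η x * w none x ≤ b)
    (h1 : ∀ y, ∑ x, α y x * w (some y) x ≤ b) :
    ∑ x, stepProb α η path (Function.update z i x) i *
      w ((ancestor path i).map (Function.update z i x)) x ≤ b := by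
  rcases hA : ancestor path i with _ | j
  · simpa [stepProb, hA] using h0
  · have hj : j ≠ i := (ancestor_eq_some hA).1.ne
    simpa [stepProb, hA, Function.update_of_ne hj] using h1 (z j)

lemma sum_stepProb_le (α : Z → PMF Z) (η : PMF Z) (z : ℕ → Z) (i : ℕ) :
    ∑ x, stepProb α η path (Function.update z i x) i ≤ 1 := by
  simpa using sum_stepProb_mul_le (path := path) α η z i (fun _ _ => 1) (b := 1)
    (by simp [sum_pmf]) (by simp [sum_pmf])

/-! ### Changes of measure -/

variable [MeasurableSpace Z] {Ω : Type*} [MeasurableSpace Ω] {P : Measure Ω} {X : ℕ → Ω → Z}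
  {α : Z → PMF Z} {η : PMF Z}

/-- Change of measure. If the weights `c i` are sub-probability weights given the past and if the
likelihood is at most `ε` times their product on a set `E` of sequences, then `E` has probability
at most `ε`. -/
lemma IsEdgeProcess.measure_le_of_likelihood_le (hX : IsEdgeProcess P X α η path) (n : ℕ)
    (c : ℕ → (ℕ → Z) → ℝ≥0∞) (hadapt : ∀ i z z', (∀ j ≤ i, z j = z' j) → c i z = c i z')
    (hsub : ∀ i z, ∑ x, c i (Function.update z i x) ≤ 1) (E : Set (ℕ → Z)) (ε : ℝ≥0∞)
    (hE : ∀ z ∈ E, likelihood α η path z n ≤ ε * ∏ i ∈ Finset.range n, c i z) :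
    P {ω | (fun i => X i ω) ∈ E} ≤ ε := by
  -- backward induction over the length of the word on which one conditions
  have key : ∀ d ≤ n, ∀ z : ℕ → Z,
      P {ω | (fun i => X i ω) ∈ E ∧ ∀ j < n - d, X j ω = z j} ≤
        ε * ∏ j ∈ Finset.range (n - d), c j z := by
    intro d
    induction d with
    | zero =>
      intro _ z
      rcases Set.eq_empty_or_nonempty
        {ω | (fun i => X i ω) ∈ E ∧ ∀ j < n - 0, X j ω = z j} with h | ⟨ω, hω, hz⟩
      · rw [h]; simp
      · calc P {ω | (fun i => X i ω) ∈ E ∧ ∀ j < n - 0, X j ω = z j}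
            ≤ P {ω | ∀ i < n, X i ω = z i} := measure_mono fun ω h => h.2
          _ = likelihood α η path (fun i => X i ω) n := by
              rw [hX.law]; exact likelihood_congr fun j hj => (hz j hj).symm
          _ ≤ _ := hE _ hω
          _ = _ := by
              congr 1
              refine Finset.prod_congr rfl fun i hi => hadapt i _ _ fun j hj => hz j ?_
              rw [Nat.sub_zero]
              exact hj.trans_lt (Finset.mem_range.mp hi)
    | succ d ih =>
      intro hd z
      set i := n - (d + 1) with hi
      have hi' : n - d = i + 1 := by omega
      have ih := ih (by omega)
      rw [hi'] at ih
      calc P {ω | (fun i => X i ω) ∈ E ∧ ∀ j < i, X j ω = z j}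
          ≤ P (⋃ x, {ω | (fun i => X i ω) ∈ E ∧
              ∀ j < i + 1, X j ω = Function.update z i x j}) := by
            refine measure_mono fun ω hω => Set.mem_iUnion.mpr ⟨X i ω, hω.1, fun j hj => ?_⟩
            rcases Nat.lt_succ_iff_lt_or_eq.mp hj with hlt | rfl
            · rw [Function.update_of_ne hlt.ne]; exact hω.2 j hlt
            · simp
        _ ≤ ∑ x, P {ω | (fun i => X i ω) ∈ E ∧
              ∀ j < i + 1, X j ω = Function.update z i x j} := measure_iUnion_fintype_le _ _
        _ ≤ ∑ x, ε * ∏ j ∈ Finset.range (i + 1), c j (Function.update z i x) :=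
            Finset.sum_le_sum fun x _ => ih _
        _ = ε * (∏ j ∈ Finset.range i, c j z) * ∑ x, c i (Function.update z i x) := by
            rw [Finset.mul_sum]
            refine Finset.sum_congr rfl fun x _ => ?_
            rw [Finset.prod_range_succ, mul_assoc]
            congr 2
            refine Finset.prod_congr rfl fun j hj => hadapt j _ _ fun l hl => ?_
            exact Function.update_of_ne (hl.trans_lt (Finset.mem_range.mp hj)).ne _ _
        _ ≤ ε * (∏ j ∈ Finset.range i, c j z) * 1 := by gcongr; exact hsub i z
        _ = _ := mul_one _
  rcases isEmpty_or_nonempty Ω with h | ⟨⟨ω⟩⟩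
  · simp [Set.eq_empty_of_isEmpty]
  · simpa using key n le_rfl (fun i => X i ω)

lemma IsEdgeProcess.ae_likelihood_ne_zero (hX : IsEdgeProcess P X α η path) :
    ∀ᵐ ω ∂P, ∀ n, likelihood α η path (fun i => X i ω) n ≠ 0 := by
  rw [ae_all_iff]
  intro n
  have := hX.measure_le_of_likelihood_le n (fun i z => stepProb α η path z i)
    (fun i z z' h => stepProb_congr h) (fun i z => sum_stepProb_le α η z i)
    {z | likelihood α η path z n = 0} 0 (fun z hz => by simpa using hz)
  rw [ae_iff]
  simpa using this

/-- Ville's inequality for the likelihood ratio up to a finite horizon `N`. -/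
lemma IsEdgeProcess.measure_exists_le_likelihood_le (hX : IsEdgeProcess P X α η path)
    (β : Z → PMF Z) (θ : PMF Z) {B : ℝ≥0∞} (hB0 : B ≠ 0) (hB : B ≠ ∞) (N : ℕ) :
    P {ω | ∃ n ≤ N, B * likelihood α η path (fun i => X i ω) n ≤
      likelihood β θ path (fun i => X i ω) n} ≤ B⁻¹ := by
  classical
  -- follow the alternative up to the crossing time and the true law afterwards
  let hit : ℕ → (ℕ → Z) → Prop := fun i z =>
    ∃ n ≤ i, B * likelihood α η path z n ≤ likelihood β θ path z n
  have hit_congr : ∀ i (z z' : ℕ → Z), (∀ j < i, z j = z' j) → (hit i z ↔ hit i z') := by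
    intro i z z' h
    refine exists_congr fun n => and_congr_right fun hn => ?_
    rw [likelihood_congr fun j hj => h j (hj.trans_le hn),
      likelihood_congr (α := β) fun j hj => h j (hj.trans_le hn)]
  let c : ℕ → (ℕ → Z) → ℝ≥0∞ := fun i z =>
    if hit i z then stepProb α η path z i else stepProb β θ path z i
  have hc : ∀ (z : ℕ → Z) n, (¬ hit n z ∧
        ∏ i ∈ Finset.range n, c i z = likelihood β θ path z n) ∨
      (hit n z ∧ B * likelihood α η path z n ≤ ∏ i ∈ Finset.range n, c i z) := by
    intro z n
    induction n with
    | zero =>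
      by_cases h : hit 0 z
      · refine Or.inr ⟨h, ?_⟩
        obtain ⟨m, hm, hle⟩ := h
        obtain rfl := Nat.le_zero.mp hm
        simpa [likelihood] using hle
      · exact Or.inl ⟨h, by simp [likelihood]⟩
    | succ n ih =>
      have hmono : hit n z → hit (n + 1) z := fun ⟨m, hm, hle⟩ => ⟨m, hm.trans n.le_succ, hle⟩
      rw [Finset.prod_range_succ]
      rcases ih with ⟨hn, heq⟩ | ⟨hn, hle⟩
      · have hcn : c n z = stepProb β θ path z n := if_neg hn
        rw [heq, hcn, ← likelihood_succ]
        by_cases h : hit (n + 1) z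
        · refine Or.inr ⟨h, ?_⟩
          obtain ⟨m, hm, hle⟩ := h
          rcases Nat.le_succ_iff.mp hm with hm | rfl
          · exact absurd ⟨m, hm, hle⟩ hn
          · exact hle
        · exact Or.inl ⟨h, rfl⟩
      · have hcn : c n z = stepProb α η path z n := if_pos hn
        refine Or.inr ⟨hmono hn, ?_⟩
        rw [hcn, likelihood_succ, ← mul_assoc]
        gcongr
  refine hX.measure_le_of_likelihood_le N c ?_ ?_ {z | hit N z} B⁻¹ ?_
  · intro i z z' h
    simp only [c]
    rw [stepProb_congr h, stepProb_congr (α := β) h]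
    simp only [hit_congr i z z' fun j hj => h j hj.le]
  · intro i z
    have : ∀ x, hit i (Function.update z i x) ↔ hit i z := fun x =>
      hit_congr i _ _ fun j hj => Function.update_of_ne hj.ne _ _
    simp only [c, this]
    split_ifs
    · exact sum_stepProb_le α η z i
    · exact sum_stepProb_le β θ z i
  · intro z hz
    rcases hc z N with ⟨h, -⟩ | ⟨-, h⟩
    · exact absurd hz h
    · rw [← ENNReal.div_eq_inv_mul, ENNReal.le_div_iff_mul_le (Or.inl hB0) (Or.inl hB), mul_comm]
      exact h

/-- The likelihood ratio of any alternative stays bounded almost surely. -/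
lemma IsEdgeProcess.ae_exists_likelihood_le (hX : IsEdgeProcess P X α η path)
    (β : Z → PMF Z) (θ : PMF Z) :
    ∀ᵐ ω ∂P, ∃ B : ℕ, ∀ n, likelihood β θ path (fun i => X i ω) n ≤
      B * likelihood α η path (fun i => X i ω) n := by
  rw [ae_iff]
  have hle : ∀ B : ℕ, P {ω | ¬ ∃ B : ℕ, ∀ n, likelihood β θ path (fun i => X i ω) n ≤
      B * likelihood α η path (fun i => X i ω) n} ≤ ((B + 1 : ℕ) : ℝ≥0∞)⁻¹ := by
    intro B
    calc _ ≤ P (⋃ N : ℕ, {ω | ∃ n ≤ N, ((B + 1 : ℕ) : ℝ≥0∞) *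
          likelihood α η path (fun i => X i ω) n ≤
            likelihood β θ path (fun i => X i ω) n}) := by
          refine measure_mono fun ω hω => ?_
          simp only [Set.mem_ofPred_eq, not_exists, not_forall, not_le] at hω
          obtain ⟨n, hn⟩ := hω (B + 1)
          exact Set.mem_iUnion.mpr ⟨n, n, le_rfl, hn.le⟩
      _ = ⨆ N : ℕ, P {ω | ∃ n ≤ N, ((B + 1 : ℕ) : ℝ≥0∞) *
          likelihood α η path (fun i => X i ω) n ≤
            likelihood β θ path (fun i => X i ω) n} := by
          refine Monotone.measure_iUnion fun N N' hN ω hω => ?_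
          obtain ⟨n, hn, h⟩ := hω
          exact ⟨n, hn.trans hN, h⟩
      _ ≤ _ := iSup_le fun N => hX.measure_exists_le_likelihood_le β θ (by simp)
          (ENNReal.natCast_ne_top _) N
  refine le_antisymm (ge_of_tendsto' (ENNReal.tendsto_inv_nat_nhds_zero.comp
    (tendsto_add_atTop_nat 1)) hle) zero_le

end

section

variable {Z ι : Type*} [DecidableEq ι] {path : ℕ → ι}

/-! ### Sums along the paths -/

/-- The sum over `i < n` of `g (z j) (z i)`, where `j` is the ancestor of `i`; an observation without
ancestor contributes the constant `b`. -/
noncomputable def pathSum (path : ℕ → ι) (b : ℝ) (g : Z → Z → ℝ) (z : ℕ → Z) (n : ℕ) : ℝ :=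
  ∑ i ∈ Finset.range n, ((ancestor path i).map z).elim b (fun y => g y (z i))

lemma pathSum_neg (b : ℝ) (g : Z → Z → ℝ) (z : ℕ → Z) (n : ℕ) :
    pathSum path (-b) (fun y x => -g y x) z n = -pathSum path b g z n := by
  unfold pathSum
  rw [← Finset.sum_neg_distrib]
  refine Finset.sum_congr rfl fun i _ => ?_
  cases ancestor path i <;> rfl

lemma card_filter_ancestor_eq_none_le (path : ℕ → ι) (n : ℕ) :
    ((Finset.range n).filter fun i => ancestor path i = none).card ≤
      ((Finset.range n).image path).card := by
  refine Finset.card_le_card_of_injOn path (fun i hi => ?_) ?_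
  · simp only [Finset.coe_filter, Finset.mem_range, Set.mem_ofPred_eq] at hi
    exact Finset.mem_image_of_mem _ (Finset.mem_range.mpr hi.1)
  · intro i hi i' hi' h
    simp only [Finset.coe_filter, Finset.mem_range, Set.mem_ofPred_eq] at hi hi'
    rcases lt_trichotomy i i' with hlt | heq | hgt
    · exact absurd h (ancestor_eq_none_iff.mp hi'.2 i hlt)
    · exact heq
    · exact absurd h.symm (ancestor_eq_none_iff.mp hi.2 i' hgt)

/-- The values of `u` telescope along each path, so that only the two ends of each path survive. -/
lemma pathSum_sub_le {u : Z → ℝ} {U : ℝ} (hu : ∀ x, |u x| ≤ U) (z : ℕ → Z) (n : ℕ) :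
    pathSum path 0 (fun y x => u y - u x) z n ≤ 2 * U * ((Finset.range n).image path).card := by
  set F := (Finset.range n).filter fun i => ancestor path i = none with hF
  set I := (Finset.range n).filter fun i => ¬ ancestor path i = none with hI
  -- the observations that are the ancestor of another one
  set J := I.image (fun i => (ancestor path i).getD 0) with hJ
  have hmem : ∀ i ∈ I, ∃ j, ancestor path i = some j := fun i hi =>
    Option.ne_none_iff_exists'.mp (Finset.mem_filter.mp hi).2
  have hinj : Set.InjOn (fun i => (ancestor path i).getD 0) (I : Set ℕ) := by
    intro i hi i' hi' h
    obtain ⟨j, hj⟩ := hmem i hi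
    obtain ⟨j', hj'⟩ := hmem i' hi'
    simp only [hj, hj', Option.getD_some] at h
    subst h
    exact ancestor_injective hj hj'
  have hJsub : J ⊆ Finset.range n := by
    intro j hj
    obtain ⟨i, hi, rfl⟩ := Finset.mem_image.mp hj
    obtain ⟨j', hj'⟩ := hmem i hi
    have := (ancestor_eq_some hj').1
    have := Finset.mem_range.mp (Finset.mem_filter.mp hi).1
    simp only [hj', Option.getD_some, Finset.mem_range]
    omega
  have hcard : F.card + I.card = n := by
    have := Finset.card_filter_add_card_filter_not (s := Finset.range n)
      (fun i => ancestor path i = none)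
    rwa [Finset.card_range] at this
  have hcardJ : J.card = I.card := Finset.card_image_of_injOn hinj
  have hcardE : (Finset.range n \ J).card = F.card := by
    rw [Finset.card_sdiff_of_subset hJsub, Finset.card_range]; omega
  have hsum : pathSum path 0 (fun y x => u y - u x) z n =
      ∑ j ∈ J, u (z j) - ∑ i ∈ I, u (z i) := by
    rw [hJ, Finset.sum_image hinj, ← Finset.sum_sub_distrib]
    unfold pathSum
    rw [← Finset.sum_filter_add_sum_filter_not _ (fun i => ancestor path i = none)]
    rw [Finset.sum_eq_zero (s := F) (fun i hi => by
      rw [(Finset.mem_filter.mp hi).2]; rfl), zero_add]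
    refine Finset.sum_congr rfl fun i hi => ?_
    obtain ⟨j, hj⟩ := hmem i hi
    simp [hj]
  have h1 : ∑ j ∈ J, u (z j) = ∑ i ∈ Finset.range n, u (z i) -
      ∑ i ∈ Finset.range n \ J, u (z i) := by
    rw [← Finset.sum_sdiff hJsub]; ring
  have h2 : ∑ i ∈ I, u (z i) = ∑ i ∈ Finset.range n, u (z i) - ∑ i ∈ F, u (z i) := by
    rw [← Finset.sum_filter_add_sum_filter_not (Finset.range n) (fun i => ancestor path i = none)]
    ring
  have h3 : ∑ i ∈ F, u (z i) ≤ F.card * U := by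
    simpa using Finset.sum_le_card_nsmul F _ U fun i _ => (le_abs_self _).trans (hu (z i))
  have h4 : -∑ i ∈ Finset.range n \ J, u (z i) ≤ F.card * U := by
    rw [← Finset.sum_neg_distrib, ← hcardE]
    simpa using Finset.sum_le_card_nsmul (Finset.range n \ J) _ U
      fun i _ => (neg_le_abs _).trans (hu (z i))
  have h5 : (F.card : ℝ) ≤ ((Finset.range n).image path).card := by
    exact_mod_cast card_filter_ancestor_eq_none_le path n
  have hU : 0 ≤ U := (abs_nonneg _).trans (hu (z 0))
  rw [hsum, h1, h2]
  nlinarith [mul_le_mul_of_nonneg_left h5 hU]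

/-- Splitting `g = D + φ + (u y - u x)`: up to a multiple of the number of paths, the sum of `g` is
`n D` plus the sum of `φ`. -/
lemma pathSum_le_of_eq {b D U : ℝ} {g φ : Z → Z → ℝ} {u : Z → ℝ}
    (hg : ∀ y x, g y x = D + φ y x + (u y - u x)) (hu : ∀ x, |u x| ≤ U) (z : ℕ → Z) (n : ℕ) :
    pathSum path b g z n ≤ n * D + pathSum path 0 φ z n +
      (|b - D| + 2 * U) * ((Finset.range n).image path).card := by
  have hsplit : pathSum path b g z n = n * D + pathSum path 0 φ z n +
      pathSum path 0 (fun y x => u y - u x) z n +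
        ∑ i ∈ Finset.range n, if ancestor path i = none then b - D else 0 := by
    have hn : (n : ℝ) * D = ∑ i ∈ Finset.range n, D := by simp
    rw [hn]
    unfold pathSum
    rw [← Finset.sum_add_distrib, ← Finset.sum_add_distrib, ← Finset.sum_add_distrib]
    refine Finset.sum_congr rfl fun i _ => ?_
    rcases ancestor path i with _ | j
    · simp
    · simp [hg]
  have hfirst : (∑ i ∈ Finset.range n, if ancestor path i = none then b - D else 0) ≤
      |b - D| * ((Finset.range n).image path).card := by
    rw [← Finset.sum_filter, Finset.sum_const, nsmul_eq_mul, mul_comm]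
    have h5 : (((Finset.range n).filter fun i => ancestor path i = none).card : ℝ) ≤
        ((Finset.range n).image path).card := by
      exact_mod_cast card_filter_ancestor_eq_none_le path n
    exact mul_le_mul (le_abs_self _) h5 (by positivity) (abs_nonneg _)
  have := pathSum_sub_le (path := path) hu z n
  rw [hsplit]
  linarith

variable [Fintype Z]

lemma sum_toReal_pmf (p : PMF Z) : ∑ x, (p x).toReal = 1 := by
  rw [← ENNReal.toReal_sum fun x _ => p.apply_ne_top x, sum_pmf, ENNReal.toReal_one]

/-- An exponential moment bound for a centred bounded variable. -/
lemma sum_mul_exp_le_one (p : PMF Z) {f : Z → ℝ} {B s : ℝ} (hmean : ∑ x, (p x).toReal * f x = 0)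
    (hB : ∀ x, |f x| ≤ B) (hs : 0 ≤ s) (hsB : s * B ≤ 1) :
    ∑ x, p x * ENNReal.ofReal (Real.exp (s * f x - (s * B) ^ 2)) ≤ 1 := by
  have hreal : ∑ x, (p x).toReal * Real.exp (s * f x - (s * B) ^ 2) ≤ 1 := by
    have hterm : ∀ x, Real.exp (s * f x) ≤ 1 + s * f x + (s * B) ^ 2 := by
      intro x
      have h1 : |s * f x| ≤ s * B := by
        rw [abs_mul, abs_of_nonneg hs]
        exact mul_le_mul_of_nonneg_left (hB x) hs
      have h2 := le_of_abs_le (Real.abs_exp_sub_one_sub_id_le (h1.trans hsB))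
      have h3 := pow_le_pow_left₀ (abs_nonneg _) h1 2
      rw [sq_abs] at h3
      linarith
    calc ∑ x, (p x).toReal * Real.exp (s * f x - (s * B) ^ 2)
        ≤ ∑ x, (p x).toReal * ((1 + s * f x + (s * B) ^ 2) * Real.exp (-(s * B) ^ 2)) := by
          refine Finset.sum_le_sum fun x _ => ?_
          rw [sub_eq_add_neg, Real.exp_add]
          gcongr
          exact hterm x
      _ = ((1 + (s * B) ^ 2) * ∑ x, (p x).toReal + s * ∑ x, (p x).toReal * f x) *
            Real.exp (-(s * B) ^ 2) := by
          rw [Finset.mul_sum, Finset.mul_sum, ← Finset.sum_add_distrib, Finset.sum_mul]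
          exact Finset.sum_congr rfl fun x _ => by ring
      _ ≤ Real.exp ((s * B) ^ 2) * Real.exp (-(s * B) ^ 2) := by
          rw [hmean, sum_toReal_pmf]
          gcongr
          linarith [Real.add_one_le_exp ((s * B) ^ 2)]
      _ = 1 := by rw [← Real.exp_add]; simp
  calc ∑ x, p x * ENNReal.ofReal (Real.exp (s * f x - (s * B) ^ 2))
      = ENNReal.ofReal (∑ x, (p x).toReal * Real.exp (s * f x - (s * B) ^ 2)) := by
        rw [ENNReal.ofReal_sum_of_nonneg fun x _ => by positivity]
        refine Finset.sum_congr rfl fun x _ => ?_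
        rw [ENNReal.ofReal_mul ENNReal.toReal_nonneg, ENNReal.ofReal_toReal (p.apply_ne_top x)]
    _ ≤ 1 := ENNReal.ofReal_le_one.mpr hreal

/-! ### Concentration -/

section Concentration

variable [MeasurableSpace Z] {Ω : Type*} [MeasurableSpace Ω] {P : Measure Ω} {X : ℕ → Ω → Z}
  {α : Z → PMF Z} {η : PMF Z}

/-- Chernoff bound for sums along the paths of a function that is centred given the ancestor. -/
lemma IsEdgeProcess.exists_measure_pathSum_le (hX : IsEdgeProcess P X α η path)
    {φ : Z → Z → ℝ} (hmean : ∀ y, ∑ x, (α y x).toReal * φ y x = 0) {δ : ℝ} (hδ : 0 < δ) :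
    ∃ r > 0, ∀ n : ℕ, P {ω | n * δ ≤ pathSum path 0 φ (fun i => X i ω) n} ≤
      ENNReal.ofReal (Real.exp (-(r * n))) := by
  obtain ⟨B, hB1, hB⟩ : ∃ B : ℝ, 1 ≤ B ∧ ∀ y x, |φ y x| ≤ B := by
    refine ⟨1 + ∑ y, ∑ x, |φ y x|, ?_, fun y x => ?_⟩
    · have : 0 ≤ ∑ y, ∑ x, |φ y x| := by positivity
      linarith
    · have h1 := Finset.single_le_sum (f := fun x => |φ y x|) (fun _ _ => abs_nonneg _)
        (Finset.mem_univ x)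
      have h2 := Finset.single_le_sum (f := fun y => ∑ x, |φ y x|)
        (fun _ _ => by positivity) (Finset.mem_univ y)
      linarith
  have hB0 : 0 < B := by linarith
  -- the tilting parameter: small enough for the moment bound, and for the linear term to win
  set s := min (1 / B) (δ / (2 * B ^ 2)) with hs
  have hs0 : 0 < s := by positivity
  have hsB : s * B ≤ 1 := by
    rw [← le_div_iff₀ hB0]; exact min_le_left _ _
  have hsδ : s * B ^ 2 ≤ δ / 2 := by
    have : s ≤ δ / 2 / B ^ 2 := (min_le_right _ _).trans_eq (by field_simp)
    rwa [le_div_iff₀ (by positivity)] at this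
  refine ⟨s * δ / 2, by positivity, fun n => ?_⟩
  let w : Option Z → Z → ℝ≥0∞ := fun o x =>
    ENNReal.ofReal (Real.exp (s * o.elim 0 (fun y => φ y x) - (s * B) ^ 2))
  refine hX.measure_le_of_likelihood_le n
    (fun i z => stepProb α η path z i * w ((ancestor path i).map z) (z i)) ?_ ?_
    {z | n * δ ≤ pathSum path 0 φ z n} _ ?_
  · intro i z z' h
    rw [stepProb_congr h, h i le_rfl]
    rcases hA : ancestor path i with _ | j
    · rfl
    · simp [h j (ancestor_eq_some hA).1.le]
  · intro i z
    simp only [Function.update_self]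
    refine sum_stepProb_mul_le α η z i w ?_ fun y => ?_
    · exact sum_mul_exp_le_one η (f := fun _ => 0) (by simp) (by simp [hB0.le]) hs0.le hsB
    · exact sum_mul_exp_le_one (α y) (hmean y) (hB y) hs0.le hsB
  · intro z hz
    rw [Finset.prod_mul_distrib, mul_left_comm]
    refine le_mul_of_one_le_right' ?_
    simp only [w]
    rw [← ENNReal.ofReal_prod_of_nonneg (fun _ _ => (Real.exp_pos _).le), ← Real.exp_sum,
      ← ENNReal.ofReal_mul (Real.exp_pos _).le, ← Real.exp_add, ENNReal.one_le_ofReal,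
      Real.one_le_exp_iff, Finset.sum_sub_distrib, ← Finset.mul_sum]
    have hz' : n * δ ≤ ∑ i ∈ Finset.range n,
        ((ancestor path i).map z).elim 0 (fun y => φ y (z i)) := hz
    simp only [Finset.sum_const, Finset.card_range, nsmul_eq_mul]
    nlinarith [mul_le_mul_of_nonneg_left hz' hs0.le, mul_le_mul_of_nonneg_left hsδ hs0.le,
      mul_le_mul_of_nonneg_left (mul_le_mul_of_nonneg_left hsδ hs0.le) (Nat.cast_nonneg (α := ℝ) n)]

end Concentration

/-! ### The Poisson equation of an irreducible kernel -/

/-- The action of a kernel on functions: `u ↦ (z ↦ ∑ x, α z x * u x)`. -/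
noncomputable def kernelOp (α : Z → PMF Z) : (Z → ℝ) →ₗ[ℝ] (Z → ℝ) where
  toFun u z := ∑ x, (α z x).toReal * u x
  map_add' u v := by ext z; simp [mul_add, Finset.sum_add_distrib]
  map_smul' c u := by
    ext z
    simp only [Pi.smul_apply, smul_eq_mul, RingHom.id_apply, Finset.mul_sum]
    exact Finset.sum_congr rfl fun x _ => by ring

/-- Integration against a probability law, as a linear functional. -/
noncomputable def meanOp (ρ : PMF Z) : (Z → ℝ) →ₗ[ℝ] ℝ where
  toFun u := ∑ x, (ρ x).toReal * u x
  map_add' u v := by simp [mul_add, Finset.sum_add_distrib]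
  map_smul' c u := by
    simp only [Pi.smul_apply, smul_eq_mul, RingHom.id_apply, Finset.mul_sum]
    exact Finset.sum_congr rfl fun x _ => by ring

lemma meanOp_kernelOp {α : Z → PMF Z} {ρ : PMF Z} (hρ : ρ.bind α = ρ) (u : Z → ℝ) :
    meanOp ρ (kernelOp α u) = meanOp ρ u := by
  have hx : ∀ x, ∑ z, (ρ z).toReal * (α z x).toReal = (ρ x).toReal := by
    intro x
    conv_rhs => rw [← hρ, PMF.bind_apply, tsum_fintype, ENNReal.toReal_sum
      fun z _ => ENNReal.mul_ne_top (ρ.apply_ne_top z) ((α z).apply_ne_top x)]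
    simp
  simp only [meanOp, kernelOp, LinearMap.coe_mk, AddHom.coe_mk, Finset.mul_sum]
  rw [Finset.sum_comm]
  refine Finset.sum_congr rfl fun x _ => ?_
  rw [← hx x, Finset.sum_mul]
  exact Finset.sum_congr rfl fun z _ => by ring

/-- The maximum principle: harmonic functions of an irreducible kernel are constant. -/
lemma IrreducibleKernel.eq_of_kernelOp_eq {α : Z → PMF Z} (hirr : IrreducibleKernel α)
    {u : Z → ℝ} (hu : kernelOp α u = u) (z z' : Z) : u z = u z' := by
  obtain ⟨m, -, hm⟩ := Finset.exists_max_image Finset.univ u ⟨z, Finset.mem_univ z⟩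
  have key : ∀ y, u y = u m := by
    intro y
    induction hirr m y with
    | refl => rfl
    | @tail y x _ hyx ih =>
      have hsum : ∑ x, (α y x).toReal * (u m - u x) = 0 := by
        have h1 : ∑ x, (α y x).toReal * u x = u y := congrFun hu y
        simp only [mul_sub, Finset.sum_sub_distrib, ← Finset.sum_mul, sum_toReal_pmf, h1, ih]
        ring
      have h0 := (Finset.sum_eq_zero_iff_of_nonneg fun x _ => mul_nonneg ENNReal.toReal_nonneg
        (sub_nonneg.mpr (hm x (Finset.mem_univ x)))).mp hsum x (Finset.mem_univ x)
      rcases mul_eq_zero.mp h0 with h | h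
      · exact absurd h (ENNReal.toReal_pos hyx.ne' ((α y).apply_ne_top x)).ne'
      · linarith
  rw [key z, key z']

/-- The Poisson equation `u - α u = d - ρ d` has a solution when `α` is irreducible with stationary
law `ρ`: the range of `1 - α` has codimension one, so it is the kernel of `ρ`. -/
lemma IrreducibleKernel.exists_sub_kernelOp_eq {α : Z → PMF Z} (hirr : IrreducibleKernel α)
    {ρ : PMF Z} (hρ : ρ.bind α = ρ) (d : Z → ℝ) :
    ∃ u : Z → ℝ, ∀ z, u z - kernelOp α u z = d z - meanOp ρ d := by
  let T : (Z → ℝ) →ₗ[ℝ] (Z → ℝ) := LinearMap.id - kernelOp α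
  have hone : meanOp ρ (fun _ => 1) = 1 := by simp [meanOp, sum_toReal_pmf]
  have hle : LinearMap.range T ≤ LinearMap.ker (meanOp ρ) := by
    rintro _ ⟨u, rfl⟩
    simp [T, meanOp_kernelOp hρ]
  have hker : LinearMap.ker T ≤ Submodule.span ℝ {fun _ => (1 : ℝ)} := by
    intro u hu
    have hu' : kernelOp α u = u := by
      have : u - kernelOp α u = 0 := hu
      exact (sub_eq_zero.mp this).symm
    obtain ⟨z, -⟩ := ρ.support_nonempty
    refine Submodule.mem_span_singleton.mpr ⟨u z, ?_⟩
    ext x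
    simpa using hirr.eq_of_kernelOp_eq hu' z x
  have hdker : Module.finrank ℝ (LinearMap.ker T) ≤ 1 :=
    (Submodule.finrank_mono hker).trans ((finrank_span_le_card _).trans (by simp))
  have h1 := LinearMap.finrank_range_add_finrank_ker T
  have h2 := LinearMap.finrank_range_add_finrank_ker (meanOp ρ)
  have hsurj : LinearMap.range (meanOp ρ) = ⊤ := by
    rw [LinearMap.range_eq_top]
    intro c
    exact ⟨c • fun _ => 1, by rw [map_smul, hone]; simp⟩
  rw [hsurj, finrank_top, Module.finrank_self] at h2
  have heq : LinearMap.range T = LinearMap.ker (meanOp ρ) :=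
    Submodule.eq_of_le_of_finrank_le hle (by omega)
  have hmem : d - (meanOp ρ d) • (fun _ => (1 : ℝ)) ∈ LinearMap.ker (meanOp ρ) := by
    rw [LinearMap.mem_ker, map_sub, map_smul, hone]
    simp
  rw [← heq] at hmem
  obtain ⟨u, hu⟩ := hmem
  exact ⟨u, fun z => by simpa [T] using congrFun hu z⟩

lemma IrreducibleKernel.stationary_ne_zero {α : Z → PMF Z} (hirr : IrreducibleKernel α)
    {ρ : PMF Z} (hρ : ρ.bind α = ρ) (z : Z) : ρ z ≠ 0 := by
  obtain ⟨y, hy⟩ := ρ.support_nonempty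
  induction hirr y z with
  | refl => exact hy
  | @tail w x _ hwx ih =>
    rw [← hρ, PMF.bind_apply, tsum_fintype]
    intro h0
    rcases mul_eq_zero.mp (Finset.sum_eq_zero_iff.mp h0 w (Finset.mem_univ w)) with h | h
    · exact ih h
    · exact hwx.ne' h

/-! ### Deviations from the drift -/

/-- The mean of `g` over a transition of the stationary chain. -/
noncomputable def drift (α : Z → PMF Z) (ρ : PMF Z) (g : Z → Z → ℝ) : ℝ :=
  ∑ z, (ρ z).toReal * ∑ x, (α z x).toReal * g z x

lemma drift_neg (α : Z → PMF Z) (ρ : PMF Z) (g : Z → Z → ℝ) :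
    drift α ρ (fun z x => -g z x) = -drift α ρ g := by
  simp [drift]

lemma tsum_ne_top_of_le_exp {f : ℕ → ℝ≥0∞} (hf : ∀ n, f n ≠ ∞) {r : ℝ} (hr : 0 < r) {N : ℕ}
    (h : ∀ n, N ≤ n → f n ≤ ENNReal.ofReal (Real.exp (-(r * n)))) : ∑' n, f n ≠ ∞ := by
  have hsummable : Summable fun n : ℕ => Real.exp (-(r * n)) := by
    have : (fun n : ℕ => Real.exp (-(r * n))) = fun n : ℕ => Real.exp (-r) ^ n := by
      ext n; rw [← Real.exp_nat_mul]; ring_nf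
    rw [this]
    exact summable_geometric_of_lt_one (Real.exp_pos _).le
      (Real.exp_lt_one_iff.mpr (by linarith))
  rw [← Summable.sum_add_tsum_nat_add' (f := f) (k := N) ENNReal.summable]
  refine ENNReal.add_ne_top.mpr ⟨(ENNReal.sum_lt_top.mpr fun n _ => (hf n).lt_top).ne, ?_⟩
  refine ne_top_of_le_ne_top ?_ (ENNReal.tsum_le_tsum fun n => h (n + N) (by omega))
  exact ((summable_nat_add_iff N).mpr hsummable).tsum_ofReal_ne_top

variable [MeasurableSpace Z] {Ω : Type*} [MeasurableSpace Ω] {P : Measure Ω} {X : ℕ → Ω → Z}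
  {α : Z → PMF Z} {η ρ : PMF Z}

/-- Sums along the paths exceed any multiple of `n` above the drift with summable probabilities. -/
lemma IsEdgeProcess.tsum_measure_le_pathSum_ne_top [IsProbabilityMeasure P]
    (hX : IsEdgeProcess P X α η path)
    (hpath : Tendsto (fun n : ℕ => (((Finset.range n).image path).card : ℝ) / n) atTop (𝓝 0))
    (hirr : IrreducibleKernel α) (hρ : ρ.bind α = ρ) (b : ℝ) (g : Z → Z → ℝ) {c : ℝ}
    (hc : drift α ρ g < c) :
    ∑' n : ℕ, P {ω | n * c ≤ pathSum path b g (fun i => X i ω) n} ≠ ∞ := by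
  set D := drift α ρ g with hD
  obtain ⟨u, hu⟩ := hirr.exists_sub_kernelOp_eq hρ (fun z => ∑ x, (α z x).toReal * g z x)
  set φ : Z → Z → ℝ := fun y x => g y x - D - (u y - u x) with hφ
  have hmean : ∀ y, ∑ x, (α y x).toReal * φ y x = 0 := by
    intro y
    have h1 : u y - ∑ x, (α y x).toReal * u x = ∑ x, (α y x).toReal * g y x - D := hu y
    simp only [hφ, mul_sub, Finset.sum_sub_distrib, ← Finset.sum_mul, sum_toReal_pmf]
    linarith
  obtain ⟨U, hU⟩ : ∃ U : ℝ, ∀ x, |u x| ≤ U :=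
    ⟨∑ x, |u x|, fun x => Finset.single_le_sum (f := fun x => |u x|)
      (fun _ _ => abs_nonneg _) (Finset.mem_univ x)⟩
  obtain ⟨r, hr, hchern⟩ := hX.exists_measure_pathSum_le hmean (δ := (c - D) / 2) (by linarith)
  set K := |b - D| + 2 * U
  have hev : ∀ᶠ n : ℕ in atTop, K * ((Finset.range n).image path).card ≤ n * ((c - D) / 2) := by
    have h1 : Tendsto (fun n : ℕ => K * ((((Finset.range n).image path).card : ℝ) / n)) atTop
        (𝓝 0) := by simpa using hpath.const_mul K
    filter_upwards [h1.eventually_le_const (show 0 < (c - D) / 2 by linarith),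
      eventually_gt_atTop 0] with n hn hn0
    have hn0' : (0 : ℝ) < n := by exact_mod_cast hn0
    rw [← mul_div_assoc, div_le_iff₀ hn0'] at hn
    linarith
  obtain ⟨N, hN⟩ := eventually_atTop.mp hev
  have hbound : ∀ n, N ≤ n → P {ω | n * c ≤ pathSum path b g (fun i => X i ω) n} ≤
      ENNReal.ofReal (Real.exp (-(r * n))) := by
    intro n hn
    refine (measure_mono fun ω hω => ?_).trans (hchern n)
    have h1 := pathSum_le_of_eq (path := path) (b := b) (D := D) (g := g) (φ := φ) (u := u)
      (fun y x => by simp only [hφ]; ring) hU (fun i => X i ω) n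
    have h2 := hN n hn
    have h3 : n * c ≤ pathSum path b g (fun i => X i ω) n := hω
    change n * ((c - D) / 2) ≤ pathSum path 0 φ (fun i => X i ω) n
    linarith
  exact tsum_ne_top_of_le_exp (fun n => measure_ne_top P _) hr hbound

/-- Almost surely the sums along the paths grow at most linearly, with any slope above the drift. -/
lemma IsEdgeProcess.ae_exists_pathSum_le [IsProbabilityMeasure P]
    (hX : IsEdgeProcess P X α η path)
    (hpath : Tendsto (fun n : ℕ => (((Finset.range n).image path).card : ℝ) / n) atTop (𝓝 0))
    (hirr : IrreducibleKernel α) (hρ : ρ.bind α = ρ) (b : ℝ) (g : Z → Z → ℝ) {c : ℝ}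
    (hc : drift α ρ g < c) :
    ∀ᵐ ω ∂P, ∃ C : ℝ, ∀ n : ℕ, pathSum path b g (fun i => X i ω) n ≤ n * c + C := by
  filter_upwards [ae_eventually_notMem
    (hX.tsum_measure_le_pathSum_ne_top hpath hirr hρ b g hc)] with ω hω
  obtain ⟨N, hN⟩ := eventually_atTop.mp hω
  set s := fun n : ℕ => pathSum path b g (fun i => X i ω) n - n * c
  refine ⟨∑ n ∈ Finset.range N, |s n|, fun n => ?_⟩
  have hnn : 0 ≤ ∑ n ∈ Finset.range N, |s n| := Finset.sum_nonneg fun _ _ => abs_nonneg _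
  rcases lt_or_ge n N with h | h
  · have h1 := Finset.single_le_sum (f := fun n => |s n|) (fun _ _ => abs_nonneg _)
      (Finset.mem_range.mpr h)
    have h2 := le_abs_self (s n)
    simp only [s] at h1 h2 ⊢
    linarith
  · have := hN n h
    simp only [not_le] at this
    linarith

end

section

variable {Z ι : Type*}

/-! ### Comparison of likelihoods -/

/-- The log-likelihood ratio of a single transition, with value `0` for the transitions that one of
the two kernels forbids. -/
noncomputable def transitionLLR (α β : Z → PMF Z) (z x : Z) : ℝ :=
  Real.log (α z x / β z x).toReal

lemma mul_exp_neg_transitionLLR {α β : Z → PMF Z} {z x : Z} (hα : α z x ≠ 0) (hβ : β z x ≠ 0) :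
    α z x * ENNReal.ofReal (Real.exp (-transitionLLR α β z x)) = β z x := by
  have hpos : 0 < (α z x / β z x).toReal :=
    ENNReal.toReal_pos (ENNReal.div_ne_zero.mpr ⟨hα, (β z).apply_ne_top x⟩)
      (ENNReal.div_ne_top ((α z).apply_ne_top x) hβ)
  rw [transitionLLR, Real.exp_neg, Real.exp_log hpos, ENNReal.ofReal_inv_of_pos hpos,
    ENNReal.ofReal_toReal (ENNReal.div_ne_top ((α z).apply_ne_top x) hβ),
    ENNReal.inv_div (Or.inl ((β z).apply_ne_top x)) (Or.inl hβ),
    ENNReal.mul_div_cancel hα ((α z).apply_ne_top x)]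

section Comparison

variable [DecidableEq ι] {path : ℕ → ι} {α β : Z → PMF Z} {η θ : PMF Z} {g : Z → Z → ℝ}

lemma likelihood_mul_exp_eq_prod (b : ℝ) (z : ℕ → Z) (n : ℕ) :
    likelihood α η path z n * ENNReal.ofReal (Real.exp (-pathSum path b g z n)) =
      ∏ i ∈ Finset.range n, stepProb α η path z i * ENNReal.ofReal
        (Real.exp (-((ancestor path i).map z).elim b (fun y => g y (z i)))) := by
  rw [Finset.prod_mul_distrib, ← ENNReal.ofReal_prod_of_nonneg (fun _ _ => (Real.exp_pos _).le),
    ← Real.exp_sum, Finset.sum_neg_distrib]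
  rfl

lemma likelihood_le_mul_exp {b : ℝ}
    (h : ∀ z x, α z x ≠ 0 → β z x ≤ α z x * ENNReal.ofReal (Real.exp (-g z x)))
    (h0 : ∀ x, η x ≠ 0 → θ x ≤ η x * ENNReal.ofReal (Real.exp (-b))) {z : ℕ → Z} {n : ℕ}
    (hz : likelihood α η path z n ≠ 0) :
    likelihood β θ path z n ≤
      likelihood α η path z n * ENNReal.ofReal (Real.exp (-pathSum path b g z n)) := by
  rw [likelihood_mul_exp_eq_prod]
  refine Finset.prod_le_prod' fun i hi => ?_
  have hi := Finset.prod_ne_zero_iff.mp hz i hi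
  revert hi
  unfold stepProb
  rcases ancestor path i with _ | j
  · exact h0 _
  · exact h _ _

lemma mul_exp_le_likelihood {b : ℝ}
    (h : ∀ z x, α z x * ENNReal.ofReal (Real.exp (-g z x)) ≤ β z x)
    (h0 : ∀ x, η x * ENNReal.ofReal (Real.exp (-b)) ≤ θ x) (z : ℕ → Z) (n : ℕ) :
    likelihood α η path z n * ENNReal.ofReal (Real.exp (-pathSum path b g z n)) ≤
      likelihood β θ path z n := by
  rw [likelihood_mul_exp_eq_prod]
  refine Finset.prod_le_prod' fun i _ => ?_
  unfold stepProb
  rcases ancestor path i with _ | j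
  · exact h0 _
  · exact h _ _

end Comparison

variable [Fintype Z]

/-- If `θ` charges every point that `η` charges, then `exp (-b) * η ≤ θ` for some constant `b`. -/
lemma exists_mul_exp_neg_le {η θ : PMF Z} (h : ∀ x, η x ≠ 0 → θ x ≠ 0) :
    ∃ b : ℝ, ∀ x, η x * ENNReal.ofReal (Real.exp (-b)) ≤ θ x := by
  refine ⟨∑ x, |Real.log (η x / θ x).toReal|, fun x => ?_⟩
  by_cases hη : η x = 0
  · simp [hη]
  rw [← mul_exp_neg_transitionLLR (α := fun _ : Z => η) (β := fun _ => θ) (z := x) hη (h x hη)]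
  gcongr
  exact (le_abs_self _).trans (Finset.single_le_sum
    (f := fun x => |Real.log (η x / θ x).toReal|) (fun _ _ => abs_nonneg _) (Finset.mem_univ x))

/-- Any law is at most a constant times `η` on the support of `η`. -/
lemma exists_le_mul_exp_neg (η θ : PMF Z) :
    ∃ b : ℝ, ∀ x, η x ≠ 0 → θ x ≤ η x * ENNReal.ofReal (Real.exp (-b)) := by
  refine ⟨-∑ x, |Real.log (η x / θ x).toReal|, fun x hη => ?_⟩
  by_cases hθ : θ x = 0
  · simp [hθ]
  conv_lhs =>
    rw [← mul_exp_neg_transitionLLR (α := fun _ : Z => η) (β := fun _ => θ) (z := x) hη hθ]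
  gcongr
  exact neg_le.mp ((neg_le_abs _).trans (Finset.single_le_sum
    (f := fun x => |Real.log (η x / θ x).toReal|) (fun _ _ => abs_nonneg _) (Finset.mem_univ x)))
/-! ### Divergences of laws on a finite set -/

lemma ne_zero_of_chiSq_lt_top {p q : PMF Z} (h : chiSq p q < ∞) {x : Z} (hp : p x ≠ 0) :
    q x ≠ 0 := by
  intro hq
  have htop : ∑ x, p x ^ 2 / q x = ∞ := by
    rw [ENNReal.sum_eq_top]
    refine ⟨x, Finset.mem_univ x, ?_⟩
    rw [hq, ENNReal.div_zero (pow_ne_zero 2 hp)]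
  simp [chiSq, htop] at h

lemma chiSq_lt_top {p q : PMF Z} (h : ∀ x, p x ≠ 0 → q x ≠ 0) : chiSq p q < ∞ := by
  refine tsub_le_self.trans_lt (ENNReal.sum_lt_top.mpr fun x _ => ?_)
  by_cases hp : p x = 0
  · simp [hp]
  · exact ENNReal.div_lt_top (ENNReal.pow_ne_top (p.apply_ne_top x)) (h x hp)

variable [MeasurableSpace Z] [MeasurableSingletonClass Z]

lemma toMeasure_absolutelyContinuous_iff {p q : PMF Z} :
    p.toMeasure ≪ q.toMeasure ↔ ∀ x, p x ≠ 0 → q x ≠ 0 := by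
  constructor
  · intro h x hp hq
    have := h (show q.toMeasure {x} = 0 by
      rw [PMF.toMeasure_apply_singleton _ _ (measurableSet_singleton x), hq])
    rw [PMF.toMeasure_apply_singleton _ _ (measurableSet_singleton x)] at this
    exact hp this
  · intro h s hs
    rw [PMF.toMeasure_apply_eq_zero_iff _ s.toFinite.measurableSet] at hs ⊢
    exact hs.mono_left fun x hx => h x hx

lemma toMeasure_eq_withDensity {p q : PMF Z} (h : ∀ x, p x ≠ 0 → q x ≠ 0) :
    p.toMeasure = q.toMeasure.withDensity fun x => p x / q x := by
  refine Measure.ext_of_singleton fun x => ?_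
  rw [withDensity_apply _ (measurableSet_singleton x), Measure.restrict_singleton,
    lintegral_smul_measure, lintegral_dirac,
    PMF.toMeasure_apply_singleton _ _ (measurableSet_singleton x),
    PMF.toMeasure_apply_singleton _ _ (measurableSet_singleton x), smul_eq_mul]
  by_cases hp : p x = 0
  · simp [hp]
  · exact (ENNReal.mul_div_cancel (h x hp) (q.apply_ne_top x)).symm

lemma klDiv_toMeasure_ne_top {p q : PMF Z} (h : ∀ x, p x ≠ 0 → q x ≠ 0) :
    InformationTheory.klDiv p.toMeasure q.toMeasure ≠ ∞ :=
  InformationTheory.klDiv_ne_top (toMeasure_absolutelyContinuous_iff.mpr h) Integrable.of_finite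

lemma toReal_klDiv_toMeasure {p q : PMF Z} (h : ∀ x, p x ≠ 0 → q x ≠ 0) :
    (InformationTheory.klDiv p.toMeasure q.toMeasure).toReal =
      ∑ x, (p x).toReal * Real.log (p x / q x).toReal := by
  have hac := toMeasure_absolutelyContinuous_iff.mpr h
  rw [InformationTheory.toReal_klDiv_of_measure_eq hac (by simp),
    integral_fintype Integrable.of_finite]
  refine Finset.sum_congr rfl fun x _ => ?_
  rw [Measure.real, PMF.toMeasure_apply_singleton _ _ (measurableSet_singleton x), smul_eq_mul]
  by_cases hp : p x = 0
  · simp [hp]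
  · congr 2
    rw [llr]
    congr 2
    have hae : p.toMeasure.rnDeriv q.toMeasure =ᵐ[q.toMeasure] fun x => p x / q x := by
      conv_lhs => rw [toMeasure_eq_withDensity h]
      exact Measure.rnDeriv_withDensity _ (measurable_of_finite _)
    have hx := ae_iff_of_countable.mp hae x (by
      rw [PMF.toMeasure_apply_singleton _ _ (measurableSet_singleton x)]; exact h x hp)
    exact hx

lemma condKL_ne_top {α β : Z → PMF Z} {ρ : PMF Z} (hac : ∀ z x, α z x ≠ 0 → β z x ≠ 0) :
    condKL α β ρ ≠ ∞ :=
  (ENNReal.sum_lt_top.mpr fun z _ => (ENNReal.mul_ne_top (ρ.apply_ne_top z)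
    (klDiv_toMeasure_ne_top (hac z))).lt_top).ne

lemma toReal_condKL {α β : Z → PMF Z} {ρ : PMF Z} (hac : ∀ z x, α z x ≠ 0 → β z x ≠ 0) :
    (condKL α β ρ).toReal = drift α ρ (transitionLLR α β) := by
  rw [condKL, ENNReal.toReal_sum fun z _ => ENNReal.mul_ne_top (ρ.apply_ne_top z)
    (klDiv_toMeasure_ne_top (hac z))]
  refine Finset.sum_congr rfl fun z _ => ?_
  rw [ENNReal.toReal_mul, toReal_klDiv_toMeasure (hac z)]
  rfl

lemma ne_zero_of_condKL_ne_top {α β : Z → PMF Z} {ρ : PMF Z} (hρ : ∀ z, ρ z ≠ 0)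
    (h : condKL α β ρ ≠ ∞) {z x : Z} (hα : α z x ≠ 0) : β z x ≠ 0 := by
  have hkl : InformationTheory.klDiv (α z).toMeasure (β z).toMeasure ≠ ∞ := by
    intro htop
    refine h (ENNReal.sum_eq_top.mpr ⟨z, Finset.mem_univ z, ?_⟩)
    rw [htop, ENNReal.mul_top (hρ z)]
  exact toMeasure_absolutelyContinuous_iff.mp (InformationTheory.klDiv_ne_top_iff.mp hkl).1 x hα

/-- Every level below the conditional divergence is the drift of a minorant of the log-likelihood
ratio. On a transition that `β` forbids, the log-likelihood ratio is infinite, and the minorant is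
taken as large as needed. -/
lemma exists_le_drift {α β : Z → PMF Z} {ρ : PMF Z} (hρ : ∀ z, ρ z ≠ 0) {c : ℝ}
    (hc : ENNReal.ofReal c ≤ condKL α β ρ) :
    ∃ g : Z → Z → ℝ, c ≤ drift α ρ g ∧
      ∀ z x, α z x ≠ 0 → β z x ≤ α z x * ENNReal.ofReal (Real.exp (-g z x)) := by
  classical
  by_cases hac : ∀ z x, α z x ≠ 0 → β z x ≠ 0
  · refine ⟨transitionLLR α β, ?_, fun z x hα =>
      (mul_exp_neg_transitionLLR hα (hac z x hα)).ge⟩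
    rw [← toReal_condKL hac]
    exact (ENNReal.ofReal_le_iff_le_toReal (condKL_ne_top hac)).mp hc
  · push Not at hac
    obtain ⟨z₀, x₀, hα₀, hβ₀⟩ := hac
    have hp : 0 < (ρ z₀).toReal * (α z₀ x₀).toReal :=
      mul_pos (ENNReal.toReal_pos (hρ z₀) (ρ.apply_ne_top z₀))
        (ENNReal.toReal_pos hα₀ ((α z₀).apply_ne_top x₀))
    set t := (c - drift α ρ (transitionLLR α β)) / ((ρ z₀).toReal * (α z₀ x₀).toReal) with ht
    refine ⟨fun z x => transitionLLR α β z x + if z = z₀ ∧ x = x₀ then t else 0, ?_, ?_⟩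
    · have : drift α ρ (fun z x => transitionLLR α β z x + if z = z₀ ∧ x = x₀ then t else 0) =
          drift α ρ (transitionLLR α β) + (ρ z₀).toReal * ((α z₀ x₀).toReal * t) := by
        simp only [drift, mul_add, Finset.sum_add_distrib]
        congr 1
        rw [Finset.sum_eq_single z₀ (fun z _ hz => by simp [hz]) (by simp),
          Finset.sum_eq_single x₀ (fun x _ hx => by simp [hx]) (by simp)]
        simp
      rw [this, ← mul_assoc, ht, mul_div_cancel₀ _ hp.ne']
      linarith
    · intro z x hα
      by_cases hβ : β z x = 0
      · simp [hβ]
      · have hne : ¬ (z = z₀ ∧ x = x₀) := by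
          rintro ⟨rfl, rfl⟩; exact hβ hβ₀
        simp only [hne, if_false, add_zero]
        exact (mul_exp_neg_transitionLLR hα hβ).ge

/-! ### Rates of the likelihood ratios -/

section Rates

variable [DecidableEq ι] {path : ℕ → ι} {Ω : Type*} [MeasurableSpace Ω] {P : Measure Ω}
  [IsProbabilityMeasure P] {X : ℕ → Ω → Z} {α β : Z → PMF Z} {η θ ρ : PMF Z}

/-- The likelihood ratio of `β` decays at every rate below the conditional divergence, up to
exceptional events of summable probability. -/
lemma IsEdgeProcess.tsum_measure_not_likelihood_le_ne_top (hX : IsEdgeProcess P X α η path)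
    (hpath : Tendsto (fun n : ℕ => (((Finset.range n).image path).card : ℝ) / n) atTop (𝓝 0))
    (hirr : IrreducibleKernel α) (hρ : ρ.bind α = ρ) {c : ℝ}
    (hc : ENNReal.ofReal c < condKL α β ρ) :
    ∑' n : ℕ, P {ω | ¬ likelihood β θ path (fun i => X i ω) n ≤
      likelihood α η path (fun i => X i ω) n * ENNReal.ofReal (Real.exp (-(n * c)))} ≠ ∞ := by
  obtain ⟨c', hc', hc'2⟩ : ∃ c' : ℝ, c < c' ∧ ENNReal.ofReal c' ≤ condKL α β ρ := by
    obtain ⟨q, -, h1, h2⟩ := ENNReal.lt_iff_exists_rat_btwn.mp hc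
    exact ⟨q, (ENNReal.ofReal_lt_ofReal_iff').mp h1 |>.1, h2.le⟩
  obtain ⟨g, hg, hβ⟩ := exists_le_drift (hirr.stationary_ne_zero hρ) hc'2
  obtain ⟨b, hb⟩ := exists_le_mul_exp_neg η θ
  have hdrift : drift α ρ (fun z x => -g z x) < -c := by rw [drift_neg]; linarith
  refine ne_top_of_le_ne_top
    (hX.tsum_measure_le_pathSum_ne_top hpath hirr hρ (-b) (fun z x => -g z x) hdrift)
    (ENNReal.tsum_le_tsum fun n => measure_mono_ae ?_)
  filter_upwards [hX.ae_likelihood_ne_zero] with ω hω hbad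
  change n * -c ≤ pathSum path (-b) (fun z x => -g z x) (fun i => X i ω) n
  rw [pathSum_neg]
  by_contra hlt
  refine hbad ((likelihood_le_mul_exp hβ hb (hω n)).trans ?_)
  gcongr
  linarith

/-- The likelihood ratio of `β` decays at no rate above a finite conditional divergence. -/
lemma IsEdgeProcess.ae_exists_mul_exp_le_likelihood (hX : IsEdgeProcess P X α η path)
    (hpath : Tendsto (fun n : ℕ => (((Finset.range n).image path).card : ℝ) / n) atTop (𝓝 0))
    (hirr : IrreducibleKernel α) (hρ : ρ.bind α = ρ) (hηθ : ∀ x, η x ≠ 0 → θ x ≠ 0) {c : ℝ}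
    (hc : condKL α β ρ < ENNReal.ofReal c) :
    ∀ᵐ ω ∂P, ∃ C : ℝ, ∀ n : ℕ, likelihood α η path (fun i => X i ω) n *
      ENNReal.ofReal (Real.exp (-(n * c + C))) ≤ likelihood β θ path (fun i => X i ω) n := by
  have hac : ∀ z x, α z x ≠ 0 → β z x ≠ 0 := fun z x =>
    ne_zero_of_condKL_ne_top (hirr.stationary_ne_zero hρ) hc.ne_top
  obtain ⟨b, hb⟩ := exists_mul_exp_neg_le hηθ
  have hdrift : drift α ρ (transitionLLR α β) < c := by
    rw [← toReal_condKL hac]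
    exact ENNReal.toReal_lt_of_lt_ofReal hc
  filter_upwards [hX.ae_exists_pathSum_le hpath hirr hρ b _ hdrift] with ω ⟨C, hC⟩
  refine ⟨C, fun n => le_trans ?_ (mul_exp_le_likelihood (α := α) (β := β) (g := transitionLLR α β)
    (fun z x => ?_) hb _ n)⟩
  · gcongr
    exact hC n
  · by_cases hα : α z x = 0
    · simp [hα]
    · exact (mul_exp_neg_transitionLLR hα (hac z x hα)).le

end Rates

end

/-! ### The stopping time -/

section StoppingTime

variable {Z ι : Type*} [DecidableEq ι] {path : ℕ → ι} {M : ℕ} {prior : PMF (Fin M)}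
  {α : Fin M → Z → PMF Z} {η : Fin M → PMF Z} {a : Fin M → ℝ} {z : ℕ → Z}

lemma stoppingTime_le {n : ℕ} (hn : 1 ≤ n) {m : Fin M}
    (h : ENNReal.ofReal (1 / (1 + a m)) ≤ posterior prior α η path z n m) :
    stoppingTime prior α η path a z ≤ n :=
  sInf_le ⟨n, rfl, hn, m, h⟩

lemma exists_of_stoppingTime_ne_top (h : stoppingTime prior α η path a z ≠ ⊤) :
    ∃ n : ℕ, stoppingTime prior α η path a z = n ∧ 1 ≤ n ∧
      ∃ m, ENNReal.ofReal (1 / (1 + a m)) ≤ posterior prior α η path z n m := by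
  refine csInf_mem (s := {t : ℕ∞ | ∃ n : ℕ, t = n ∧ 1 ≤ n ∧
    ∃ m, ENNReal.ofReal (1 / (1 + a m)) ≤ posterior prior α η path z n m}) ?_
  by_contra hne
  rw [Set.not_nonempty_iff_eq_empty] at hne
  exact h (by rw [stoppingTime, hne, sInf_empty])

lemma lt_stoppingTime_iff {n : ℕ} :
    (n : ℕ∞) < stoppingTime prior α η path a z ↔ ∀ m ≤ n, 1 ≤ m →
      ∀ l, ¬ ENNReal.ofReal (1 / (1 + a l)) ≤ posterior prior α η path z m l := by
  constructor
  · intro h m hm hm1 l hl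
    exact absurd ((stoppingTime_le hm1 hl).trans (Nat.cast_le.mpr hm)) h.not_ge
  · intro h
    by_contra hle
    obtain ⟨m, hm, hm1, l, hl⟩ :=
      exists_of_stoppingTime_ne_top (ne_top_of_le_ne_top (ENat.natCast_ne_top n) (not_lt.mp hle))
    rw [hm, not_lt, Nat.cast_le] at hle
    exact h m hle hm1 l hl

lemma toENNReal_eq_tsum (t : ℕ∞) : (t : ℝ≥0∞) = ∑' n : ℕ, if (n : ℕ∞) < t then 1 else 0 := by
  induction t with
  | top => simp
  | coe t =>
    rw [tsum_eq_sum (s := Finset.range t) (fun n hn => by simpa using hn)]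
    simp [← Finset.mem_range]

/-- The posterior of `k` has reached its threshold once every other likelihood is small. -/
lemma threshold_le_posterior {k : Fin M} {n : ℕ} {ε : ℝ≥0∞} (hprior : prior k ≠ 0)
    (hk : likelihood (α k) (η k) path z n ≠ 0) (ha : 0 ≤ a k)
    (h : ∀ j ≠ k, likelihood (α j) (η j) path z n ≤ likelihood (α k) (η k) path z n * ε)
    (hε : ε ≤ ENNReal.ofReal (a k) * prior k) :
    ENNReal.ofReal (1 / (1 + a k)) ≤ posterior prior α η path z n k := by
  set f := likelihood (α k) (η k) path z n with hf
  have hf' : f ≠ ∞ := likelihood_ne_top _ _ _ _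
  have hA0 : prior k * f ≠ 0 := mul_ne_zero hprior hk
  have hA : prior k * f ≠ ∞ := ENNReal.mul_ne_top (prior.apply_ne_top k) hf'
  have hsum : ∑ j, prior j * likelihood (α j) (η j) path z n ≤
      ENNReal.ofReal (1 + a k) * (prior k * f) := by
    rw [← Finset.add_sum_erase _ _ (Finset.mem_univ k), ENNReal.ofReal_add zero_le_one ha,
      ENNReal.ofReal_one, add_mul, one_mul]
    gcongr
    calc ∑ j ∈ Finset.univ.erase k, prior j * likelihood (α j) (η j) path z n
        ≤ ∑ j ∈ Finset.univ.erase k, prior j * (f * ε) := by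
          gcongr with j hj
          exact h j (Finset.ne_of_mem_erase hj)
      _ ≤ ∑ j, prior j * (f * ε) := Finset.sum_le_sum_of_subset (Finset.erase_subset _ _)
      _ = f * ε := by rw [← Finset.sum_mul, sum_pmf, one_mul]
      _ ≤ f * (ENNReal.ofReal (a k) * prior k) := by gcongr
      _ = _ := by ring
  unfold posterior
  rw [one_div, ENNReal.ofReal_inv_of_pos (by linarith)]
  calc (ENNReal.ofReal (1 + a k))⁻¹
      = prior k * f / (ENNReal.ofReal (1 + a k) * (prior k * f)) := by
        rw [div_eq_mul_inv, ENNReal.mul_inv (Or.inr hA) (Or.inr hA0), mul_left_comm,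
          ENNReal.mul_inv_cancel hA0 hA, mul_one]
    _ ≤ _ := by gcongr

/-- A posterior that has reached its threshold dominates the weight of every other hypothesis. -/
lemma prior_mul_likelihood_le_of_threshold_le {m i : Fin M} (him : i ≠ m) {n : ℕ}
    (ha : 0 ≤ a m)
    (h : ENNReal.ofReal (1 / (1 + a m)) ≤ posterior prior α η path z n m) :
    prior i * likelihood (α i) (η i) path z n ≤
      ENNReal.ofReal (a m) * (prior m * likelihood (α m) (η m) path z n) := by
  set S := ∑ j, prior j * likelihood (α j) (η j) path z n with hS
  set A := prior m * likelihood (α m) (η m) path z n with hA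
  have hAtop : A ≠ ∞ := ENNReal.mul_ne_top (prior.apply_ne_top m) (likelihood_ne_top _ _ _ _)
  have hpos : 0 < 1 + a m := by linarith
  have hSA : S ≤ ENNReal.ofReal (1 + a m) * A := by
    have h' : (ENNReal.ofReal (1 + a m))⁻¹ ≤ A / S := by
      rwa [← ENNReal.ofReal_inv_of_pos hpos, ← one_div]
    have h2 := ENNReal.mul_le_of_le_div h'
    rwa [mul_comm, ← div_eq_mul_inv, ENNReal.div_le_iff_le_mul
      (Or.inl (ENNReal.ofReal_pos.mpr hpos).ne') (Or.inl ENNReal.ofReal_ne_top), mul_comm] at h2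
  have hle : A + prior i * likelihood (α i) (η i) path z n ≤ S := by
    rw [hS, ← Finset.add_sum_erase _ _ (Finset.mem_univ m)]
    gcongr
    exact Finset.single_le_sum (f := fun j => prior j * likelihood (α j) (η j) path z n)
      (fun _ _ => zero_le) (Finset.mem_erase.mpr ⟨him, Finset.mem_univ i⟩)
  have h3 := hle.trans hSA
  rw [ENNReal.ofReal_add zero_le_one ha, ENNReal.ofReal_one, add_mul, one_mul] at h3
  exact (ENNReal.add_le_add_iff_left hAtop).mp h3

variable [Fintype Z] [MeasurableSpace Z] [MeasurableSingletonClass Z] {Ω : Type*}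
  [MeasurableSpace Ω] {X : ℕ → Ω → Z}

lemma measurable_likelihood (hX : ∀ i, Measurable (X i)) (β : Z → PMF Z) (θ : PMF Z) (n : ℕ) :
    Measurable fun ω => likelihood β θ path (fun i => X i ω) n := by
  refine Finset.measurable_fun_prod _ fun i _ => ?_
  unfold stepProb
  rcases ancestor path i with _ | j
  · exact (measurable_of_finite (fun x => θ x)).comp (hX i)
  · exact (measurable_of_finite (fun p : Z × Z => β p.1 p.2)).comp ((hX j).prodMk (hX i))

lemma measurable_stoppingTime (hX : ∀ i, Measurable (X i)) :
    Measurable fun ω =>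
      (stoppingTime prior α η path a (fun i => X i ω) : ℝ≥0∞) := by
  simp only [toENNReal_eq_tsum]
  refine Measurable.tsum fun n => Measurable.ite ?_ measurable_const measurable_const
  simp only [lt_stoppingTime_iff]
  have hpost : ∀ m l, Measurable fun ω => posterior prior α η path (fun i => X i ω) m l :=
    fun m l => ((measurable_likelihood hX _ _ m).const_mul _).div
      (Finset.measurable_fun_sum _ fun j _ => (measurable_likelihood hX _ _ m).const_mul _)
  have : {ω | ∀ m ≤ n, 1 ≤ m → ∀ l, ¬ ENNReal.ofReal (1 / (1 + a l)) ≤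
      posterior prior α η path (fun i => X i ω) m l} = ⋂ m, ⋂ (_ : m ≤ n), ⋂ (_ : 1 ≤ m), ⋂ l,
        {ω | ENNReal.ofReal (1 / (1 + a l)) ≤ posterior prior α η path (fun i => X i ω) m l}ᶜ := by
    ext ω; simp
  rw [this]
  exact .iInter fun m => .iInter fun _ => .iInter fun _ => .iInter fun l =>
    (measurableSet_le measurable_const (hpost m l)).compl

end StoppingTime

/-! ### Limits of ratios -/

section Limits

variable {A : Type*} {F : Filter A} {L : A → ℝ} {T : A → ℝ≥0∞} {D : ℝ≥0∞}

lemma tendsto_ofReal_div_add_div (hL : Tendsto L F atTop) {q : ℝ} (hq : 0 < q) (C : ℝ) :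
    Tendsto (fun a => ENNReal.ofReal (L a / q + C) / ENNReal.ofReal (L a)) F
      (𝓝 (ENNReal.ofReal q)⁻¹) := by
  have h1 : Tendsto (fun a => q⁻¹ + C / L a) F (𝓝 (q⁻¹ + 0)) :=
    tendsto_const_nhds.add (hL.const_div_atTop C)
  rw [← ENNReal.ofReal_inv_of_pos hq]
  rw [add_zero] at h1
  refine ((ENNReal.continuous_ofReal.tendsto _).comp h1).congr' ?_
  filter_upwards [hL.eventually_gt_atTop 0] with a ha
  rw [Function.comp_apply, ← ENNReal.ofReal_div_of_pos ha]
  congr 1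
  field_simp

lemma limsup_div_le (hL : Tendsto L F atTop)
    (h : ∀ q : ℚ, 0 < q → ENNReal.ofReal q < D →
      ∃ C : ℝ, ∀ᶠ a in F, T a ≤ ENNReal.ofReal (L a / q + C)) :
    limsup (fun a => T a / ENNReal.ofReal (L a)) F ≤ 1 / D := by
  refine le_of_forall_gt fun x hx => ?_
  rw [one_div] at hx
  obtain ⟨q, hq0, hq1, hq2⟩ := ENNReal.lt_iff_exists_rat_btwn.mp (ENNReal.inv_lt_iff_inv_lt.mp hx)
  change x⁻¹ < ENNReal.ofReal q at hq1
  have hqpos : (0 : ℝ) < q := ENNReal.ofReal_pos.mp (zero_le.trans_lt hq1)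
  obtain ⟨C, hC⟩ := h q (by exact_mod_cast hqpos) hq2
  rcases F.eq_or_neBot with rfl | hF
  · simpa using zero_le.trans_lt hx
  calc limsup (fun a => T a / ENNReal.ofReal (L a)) F
      ≤ limsup (fun a => ENNReal.ofReal (L a / q + C) / ENNReal.ofReal (L a)) F := by
        refine limsup_le_limsup ?_
        filter_upwards [hC] with a ha
        gcongr
    _ = (ENNReal.ofReal q)⁻¹ := (tendsto_ofReal_div_add_div hL hqpos C).limsup_eq
    _ < x := ENNReal.inv_lt_iff_inv_lt.mp hq1

lemma le_liminf_div (hL : Tendsto L F atTop)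
    (h : ∀ q : ℚ, 0 < q → D < ENNReal.ofReal q →
      ∃ C : ℝ, ∀ᶠ a in F, ENNReal.ofReal (L a / q + C) ≤ T a) :
    1 / D ≤ liminf (fun a => T a / ENNReal.ofReal (L a)) F := by
  refine le_of_forall_lt fun x hx => ?_
  rw [one_div] at hx
  obtain ⟨q, hq0, hq1, hq2⟩ := ENNReal.lt_iff_exists_rat_btwn.mp (ENNReal.lt_inv_iff_lt_inv.mp hx)
  change D < ENNReal.ofReal q at hq1
  have hqpos : (0 : ℝ) < q := ENNReal.ofReal_pos.mp (zero_le.trans_lt hq1)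
  obtain ⟨C, hC⟩ := h q (by exact_mod_cast hqpos) hq1
  rcases F.eq_or_neBot with rfl | hF
  · simpa using hx.trans_le le_top
  calc x < (ENNReal.ofReal q)⁻¹ := ENNReal.lt_inv_iff_lt_inv.mp hq2
    _ = liminf (fun a => ENNReal.ofReal (L a / q + C) / ENNReal.ofReal (L a)) F :=
        (tendsto_ofReal_div_add_div hL hqpos C).liminf_eq.symm
    _ ≤ liminf (fun a => T a / ENNReal.ofReal (L a)) F := by
        refine liminf_le_liminf ?_
        filter_upwards [hC] with a ha
        gcongr

end Limits

/-! ### Bounds for the stopping time -/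

section Bounds

variable {M : ℕ} {Z ι : Type*} [DecidableEq ι] {prior : PMF (Fin M)} {α : Fin M → Z → PMF Z}
  {η : Fin M → PMF Z} {path : ℕ → ι} {k : Fin M}

/-- If `f j` decays at rate at most `q`, and no likelihood ratio exceeds `B`, then for small
thresholds only a decision for `k` is possible, and not before the time needed at rate `q`. -/
lemma exists_eventually_le_stoppingTime (hprior : ∀ j, prior j ≠ 0) {j : Fin M} (hj : j ≠ k)
    {z : ℕ → Z} (hz : ∀ n, likelihood (α k) (η k) path z n ≠ 0)
    {B : Fin M → ℕ} (hB : ∀ m n, likelihood (α m) (η m) path z n ≤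
      B m * likelihood (α k) (η k) path z n) {q C : ℝ} (hq : 0 < q)
    (hC : ∀ n : ℕ, likelihood (α k) (η k) path z n * ENNReal.ofReal (Real.exp (-(n * q + C))) ≤
      likelihood (α j) (η j) path z n) :
    ∃ C' : ℝ, ∀ᶠ a : Fin M → ℝ in 𝓝[{a | (∀ m, 0 ≤ a m ∧ a m < 1) ∧ 0 < a k}] 0,
      ENNReal.ofReal (-Real.log (a k) / q + C') ≤
        (stoppingTime prior α η path a z : ℝ≥0∞) := by
  have hp0 : 0 < (prior j).toReal := ENNReal.toReal_pos (hprior j) (prior.apply_ne_top j)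
  refine ⟨(Real.log (prior j).toReal - C) / q, ?_⟩
  have hsmall : ∀ m, ∀ᶠ a : Fin M → ℝ in 𝓝[{a | (∀ m, 0 ≤ a m ∧ a m < 1) ∧ 0 < a k}] 0,
      ENNReal.ofReal (a m) * B m < prior k := by
    intro m
    have h1 : Tendsto (fun a : Fin M → ℝ => ENNReal.ofReal (a m) * B m)
        (𝓝[{a | (∀ m, 0 ≤ a m ∧ a m < 1) ∧ 0 < a k}] 0) (𝓝 (ENNReal.ofReal 0 * B m)) := by
      refine ENNReal.Tendsto.mul_const ?_ (Or.inr (ENNReal.natCast_ne_top _))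
      have h2 : Continuous fun a : Fin M → ℝ => ENNReal.ofReal (a m) :=
        ENNReal.continuous_ofReal.comp (continuous_apply m)
      exact (h2.tendsto 0).mono_left nhdsWithin_le_nhds
    rw [ENNReal.ofReal_zero, zero_mul] at h1
    exact h1.eventually_lt_const (pos_iff_ne_zero.mpr (hprior k))
  filter_upwards [eventually_all.mpr hsmall, self_mem_nhdsWithin] with a ha ⟨haS, hak⟩
  by_cases htop : stoppingTime prior α η path a z = ⊤
  · simp [htop]
  obtain ⟨n, hn, -, m, hm⟩ := exists_of_stoppingTime_ne_top htop
  have hf := hz n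
  have hf' : likelihood (α k) (η k) path z n ≠ ∞ := likelihood_ne_top _ _ _ _
  set f := likelihood (α k) (η k) path z n
  rcases eq_or_ne m k with rfl | hmk
  · have h1 := prior_mul_likelihood_le_of_threshold_le hj (haS m).1 hm
    have h2 : (prior j * ENNReal.ofReal (Real.exp (-(n * q + C)))) * f ≤
        ENNReal.ofReal (a m) * f := by
      calc _ = prior j * (f * ENNReal.ofReal (Real.exp (-(n * q + C)))) := by ring
        _ ≤ prior j * likelihood (α j) (η j) path z n := by gcongr; exact hC n
        _ ≤ ENNReal.ofReal (a m) * (prior m * f) := h1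
        _ ≤ ENNReal.ofReal (a m) * (1 * f) := by gcongr; exact prior.coe_le_one m
        _ = _ := by rw [one_mul]
    rw [ENNReal.mul_le_mul_iff_left hf hf', ← ENNReal.ofReal_toReal (prior.apply_ne_top j),
      ← ENNReal.ofReal_mul ENNReal.toReal_nonneg, ENNReal.ofReal_le_ofReal_iff (haS m).1] at h2
    have h3 := Real.log_le_log (mul_pos hp0 (Real.exp_pos _)) h2
    rw [Real.log_mul hp0.ne' (Real.exp_pos _).ne', Real.log_exp] at h3
    rw [hn, ENat.toENNReal_coe, ← ENNReal.ofReal_natCast]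
    refine ENNReal.ofReal_le_ofReal ?_
    rw [← add_div, div_le_iff₀ hq]
    linarith
  · exfalso
    have h1 := prior_mul_likelihood_le_of_threshold_le hmk.symm (haS m).1 hm
    have h2 : prior k * f ≤ (ENNReal.ofReal (a m) * B m) * f := by
      calc prior k * f ≤ ENNReal.ofReal (a m) * (prior m * likelihood (α m) (η m) path z n) := h1
        _ ≤ ENNReal.ofReal (a m) * (1 * (B m * f)) := by
            gcongr
            · exact prior.coe_le_one m
            · exact hB m n
        _ = _ := by ring
    rw [ENNReal.mul_le_mul_iff_left hf hf'] at h2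
    exact (ha m).not_ge h2

variable [Fintype Z] [MeasurableSpace Z] [MeasurableSingletonClass Z] {Ω : Type*}
  [MeasurableSpace Ω] {ρ : PMF Z} {P : Measure Ω} [IsProbabilityMeasure P] {X : ℕ → Ω → Z}

/-- The stopping time exceeds the time needed at rate `q` by at most an integrable variable, the
number of exceptional times at which some likelihood ratio lies above `exp (-n q)`. -/
lemma exists_stoppingTime_le (hX : IsEdgeProcess P X (α k) (η k) path)
    (hpath : Tendsto (fun n : ℕ => (((Finset.range n).image path).card : ℝ) / n) atTop (𝓝 0))
    (hprior : prior k ≠ 0) (hirr : IrreducibleKernel (α k)) (hρ : ρ.bind (α k) = ρ)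
    {q : ℝ} (hq0 : 0 < q) (hq : ∀ j ≠ k, ENNReal.ofReal q < condKL (α k) (α j) ρ) :
    ∃ (C : ℝ) (W : Ω → ℝ≥0∞), Measurable W ∧ ∫⁻ ω, W ω ∂P ≠ ∞ ∧
      ∀ᵐ ω ∂P, ∀ a : Fin M → ℝ, 0 < a k → a k < 1 →
        (stoppingTime prior α η path a (fun i => X i ω) : ℝ≥0∞) ≤
          ENNReal.ofReal (-Real.log (a k) / q + C) + W ω := by
  set bad : Fin M → ℕ → Set Ω := fun j n =>
    {ω | ¬ likelihood (α j) (η j) path (fun i => X i ω) n ≤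
      likelihood (α k) (η k) path (fun i => X i ω) n * ENNReal.ofReal (Real.exp (-(n * q)))}
    with hbad
  have hbad_sum : ∀ j ∈ Finset.univ.erase k, ∑' n, P (bad j n) ≠ ∞ := fun j hj =>
    hX.tsum_measure_not_likelihood_le_ne_top hpath hirr hρ (hq j (Finset.ne_of_mem_erase hj))
  set W : Ω → ℝ≥0∞ := fun ω => ∑' n, ∑ j ∈ Finset.univ.erase k,
    (toMeasurable P (bad j n)).indicator 1 ω with hW
  have hmeas : ∀ n, Measurable fun ω => ∑ j ∈ Finset.univ.erase k,
      (toMeasurable P (bad j n)).indicator (1 : Ω → ℝ≥0∞) ω := fun n =>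
    Finset.measurable_fun_sum _ fun j _ =>
      measurable_one.indicator (measurableSet_toMeasurable P (bad j n))
  have hp0 : 0 < (prior k).toReal := ENNReal.toReal_pos hprior (prior.apply_ne_top k)
  have hp1 : (prior k).toReal ≤ 1 := by
    simpa using ENNReal.toReal_mono ENNReal.one_ne_top (prior.coe_le_one k)
  refine ⟨-Real.log (prior k).toReal / q + 2, W, Measurable.tsum hmeas, ?_, ?_⟩
  · rw [lintegral_tsum fun n => (hmeas n).aemeasurable]
    have : ∀ n, ∫⁻ ω, ∑ j ∈ Finset.univ.erase k,
        (toMeasurable P (bad j n)).indicator (1 : Ω → ℝ≥0∞) ω ∂P =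
          ∑ j ∈ Finset.univ.erase k, P (bad j n) := by
      intro n
      rw [lintegral_finsetSum _ fun j _ =>
        measurable_one.indicator (measurableSet_toMeasurable P (bad j n))]
      refine Finset.sum_congr rfl fun j _ => ?_
      rw [lintegral_indicator_one (measurableSet_toMeasurable P (bad j n)), measure_toMeasurable]
    simp only [this]
    rw [Summable.tsum_finsetSum fun _ _ => ENNReal.summable]
    exact (ENNReal.sum_lt_top.mpr fun j hj => (hbad_sum j hj).lt_top).ne
  · filter_upwards [hX.ae_likelihood_ne_zero] with ω hω a ha0 ha1
    have hlog : 0 < -Real.log (a k) := neg_pos.mpr (Real.log_neg ha0 ha1)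
    have hlogp : 0 ≤ -Real.log (prior k).toReal :=
      neg_nonneg.mpr (Real.log_nonpos hp0.le hp1)
    set x := (-Real.log (a k) + -Real.log (prior k).toReal) / q with hx
    have hx0 : 0 ≤ x := by positivity
    -- from time `N` on, decay at rate `q` suffices for the threshold
    set N := ⌈x⌉₊ + 1 with hN
    have hN_le : (N : ℝ≥0∞) ≤
        ENNReal.ofReal (-Real.log (a k) / q + (-Real.log (prior k).toReal / q + 2)) := by
      rw [← ENNReal.ofReal_natCast]
      refine ENNReal.ofReal_le_ofReal ?_
      have := Nat.ceil_lt_add_one hx0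
      have hx' := hx.trans (add_div _ _ _)
      rw [hN]
      push_cast
      linarith
    have hcover : ∀ n : ℕ,
        (if (n : ℕ∞) < stoppingTime prior α η path a (fun i => X i ω) then 1 else 0 : ℝ≥0∞) ≤
          (if n < N then 1 else 0) + ∑ j ∈ Finset.univ.erase k,
            (toMeasurable P (bad j n)).indicator 1 ω := by
      intro n
      split_ifs with h1 h2
      · exact le_self_add
      · rw [zero_add]
        by_contra hlt
        refine h1.not_ge (stoppingTime_le (m := k) (by omega) (threshold_le_posterior hprior
          (hω n) ha0.le (ε := ENNReal.ofReal (Real.exp (-(n * q)))) (fun j hj => ?_) ?_))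
        · by_contra hj'
          refine hlt (le_trans ?_ (Finset.single_le_sum
            (f := fun j => (toMeasurable P (bad j n)).indicator (1 : Ω → ℝ≥0∞) ω)
            (fun _ _ => zero_le) (Finset.mem_erase.mpr ⟨hj, Finset.mem_univ j⟩)))
          have hmem : ω ∈ toMeasurable P (bad j n) := subset_toMeasurable P _ hj'
          simp [hmem]
        · rw [← ENNReal.ofReal_toReal (prior.apply_ne_top k), ← ENNReal.ofReal_mul ha0.le]
          refine ENNReal.ofReal_le_ofReal ?_
          rw [← Real.le_log_iff_exp_le (mul_pos ha0 hp0), Real.log_mul ha0.ne' hp0.ne']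
          have hxn : x ≤ n := (Nat.le_ceil x).trans (by exact_mod_cast (by omega : ⌈x⌉₊ ≤ n))
          rw [hx, div_le_iff₀ hq0] at hxn
          linarith
      · exact zero_le
      · exact zero_le
    calc (stoppingTime prior α η path a (fun i => X i ω) : ℝ≥0∞)
        ≤ ∑' n : ℕ, ((if n < N then 1 else 0) + ∑ j ∈ Finset.univ.erase k,
            (toMeasurable P (bad j n)).indicator 1 ω) := by
          rw [toENNReal_eq_tsum]
          exact ENNReal.tsum_le_tsum hcover
      _ = N + W ω := by
          rw [ENNReal.tsum_add, tsum_eq_sum (s := Finset.range N) (fun n hn => by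
            simpa using hn)]
          simp [← Finset.mem_range, hW]
      _ ≤ _ := by gcongr

end Bounds

end MSPRT

theorem theorem3
    {M : ℕ} {Z ι Ω : Type*} [Fintype Z] [MeasurableSpace Z] [MeasurableSingletonClass Z]
    [DecidableEq ι] [MeasurableSpace Ω]
    (prior : PMF (Fin M)) (hprior : ∀ j, 0 < prior j)
    (α : Fin M → Z → PMF Z) (η : Fin M → PMF Z)
    (path : ℕ → ι)
    (hpath : Tendsto (fun n : ℕ => (((Finset.range n).image path).card : ℝ) / n) atTop (𝓝 0))
    (k : Fin M) (hirr : MSPRT.IrreducibleKernel (α k))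
    (πstat : PMF Z) (hstat : πstat.bind (α k) = πstat)
    (hchi : (⨅ j, ⨅ _ : j ≠ k, ⨆ z, MSPRT.chiSq (α k z) (α j z)) < ∞)
    (hinit : ∀ j, j ≠ k → (⨆ z, MSPRT.chiSq (α k z) (α j z)) < ∞ →
      MSPRT.chiSq (η k) (η j) < ∞)
    (hsep : (⨅ j, ⨅ _ : j ≠ k, ⨆ z, MSPRT.affinity (α k z) (α j z)) < 1)
    (P : Measure Ω) [IsProbabilityMeasure P] (X : ℕ → Ω → Z)
    (hX : MSPRT.IsEdgeProcess P X (α k) (η k) path) :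
    (∀ᵐ ω ∂P, Tendsto
      (fun a : Fin M → ℝ =>
        (MSPRT.stoppingTime prior α η path a (fun i => X i ω) : ℝ≥0∞) /
          ENNReal.ofReal (-Real.log (a k)))
      (𝓝[{a | (∀ m, 0 ≤ a m ∧ a m < 1) ∧ 0 < a k}] 0)
      (𝓝 (1 / (⨅ j, ⨅ _ : j ≠ k, MSPRT.condKL (α k) (α j) πstat)))) ∧
    Tendsto
      (fun a : Fin M → ℝ =>
        (∫⁻ ω, (MSPRT.stoppingTime prior α η path a (fun i => X i ω) : ℝ≥0∞) ∂P) /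
          ENNReal.ofReal (-Real.log (a k)))
      (𝓝[{a | (∀ m, 0 ≤ a m ∧ a m < 1) ∧ 0 < a k}] 0)
      (𝓝 (1 / (⨅ j, ⨅ _ : j ≠ k, MSPRT.condKL (α k) (α j) πstat))) := by
  set F : Filter (Fin M → ℝ) := 𝓝[{a | (∀ m, 0 ≤ a m ∧ a m < 1) ∧ 0 < a k}] 0 with hF
  set D := ⨅ j, ⨅ _ : j ≠ k, MSPRT.condKL (α k) (α j) πstat with hD
  have hprior' : ∀ j, prior j ≠ 0 := fun j => (hprior j).ne'
  have hmemS : ∀ᶠ a : Fin M → ℝ in F, (∀ m, 0 ≤ a m ∧ a m < 1) ∧ 0 < a k := self_mem_nhdsWithin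
  have hL : Tendsto (fun a : Fin M → ℝ => -Real.log (a k)) F atTop := by
    refine tendsto_neg_atBot_atTop.comp (Real.tendsto_log_nhdsGT_zero.comp ?_)
    refine tendsto_nhdsWithin_iff.mpr ⟨?_, hmemS.mono fun a ha => ha.2⟩
    exact ((continuous_apply k).tendsto (0 : Fin M → ℝ)).mono_left nhdsWithin_le_nhds
  have hupper : ∀ q : ℚ, 0 < q → ENNReal.ofReal q < D → ∃ (C : ℝ) (W : Ω → ℝ≥0∞),
      Measurable W ∧ ∫⁻ ω, W ω ∂P ≠ ∞ ∧ ∀ᵐ ω ∂P, ∀ a : Fin M → ℝ, 0 < a k → a k < 1 →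
        (MSPRT.stoppingTime prior α η path a (fun i => X i ω) : ℝ≥0∞) ≤
          ENNReal.ofReal (-Real.log (a k) / q + C) + W ω := fun q hq0 hq =>
    MSPRT.exists_stoppingTime_le hX hpath (hprior' k) hirr hstat (by exact_mod_cast hq0)
      fun j hj => hq.trans_le (iInf₂_le j hj)
  -- a finite remainder `W` is absorbed into the additive constant
  have habsorb : ∀ (q : ℚ) (C : ℝ) (w : ℝ≥0∞), 0 < q → w ≠ ∞ → ∃ C' : ℝ,
      ∀ᶠ a : Fin M → ℝ in F, ENNReal.ofReal (-Real.log (a k) / q + C) + w ≤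
        ENNReal.ofReal (-Real.log (a k) / q + C') := by
    intro q C w hq hw
    have hq' : (0 : ℝ) < q := by exact_mod_cast hq
    refine ⟨C + w.toReal, ?_⟩
    filter_upwards [(hL.atTop_div_const hq').eventually_ge_atTop (-C)] with a ha
    rw [← add_assoc, ENNReal.ofReal_add (by linarith) ENNReal.toReal_nonneg,
      ENNReal.ofReal_toReal hw]
  -- rational rates, so that one null set serves all of them
  have hlower : ∀ᵐ ω ∂P, ∀ q : ℚ, 0 < q → D < ENNReal.ofReal q → ∃ C : ℝ, ∀ᶠ a in F,
      ENNReal.ofReal (-Real.log (a k) / q + C) ≤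
        (MSPRT.stoppingTime prior α η path a (fun i => X i ω) : ℝ≥0∞) := by
    rw [ae_all_iff]
    intro q
    by_cases hq : D < ENNReal.ofReal q
    · obtain ⟨j, hjq⟩ := iInf_lt_iff.mp hq
      obtain ⟨hj, hjq⟩ := iInf_lt_iff.mp hjq
      have hac : ∀ z x, α k z x ≠ 0 → α j z x ≠ 0 := fun z x =>
        MSPRT.ne_zero_of_condKL_ne_top (hirr.stationary_ne_zero hstat) hjq.ne_top
      have hchi_j : (⨆ z, MSPRT.chiSq (α k z) (α j z)) < ∞ := by
        obtain ⟨z, -⟩ := πstat.support_nonempty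
        have : Nonempty Z := ⟨z⟩
        obtain ⟨y, hy⟩ := exists_eq_ciSup_of_finite
          (f := fun z => MSPRT.chiSq (α k z) (α j z))
        rw [← hy]
        exact MSPRT.chiSq_lt_top (hac y)
      have hη : ∀ x, η k x ≠ 0 → η j x ≠ 0 := fun x =>
        MSPRT.ne_zero_of_chiSq_lt_top (hinit j hj hchi_j)
      filter_upwards [hX.ae_likelihood_ne_zero,
        ae_all_iff.mpr fun m => hX.ae_exists_likelihood_le (α m) (η m),
        hX.ae_exists_mul_exp_le_likelihood hpath hirr hstat hη hjq] with ω hω hB ⟨C, hC⟩ hq0 _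
      choose B hB using hB
      exact MSPRT.exists_eventually_le_stoppingTime hprior' hj hω hB (by exact_mod_cast hq0) hC
    · exact Eventually.of_forall fun ω _ h => absurd h hq
  have hliminf : ∀ᵐ ω ∂P, 1 / D ≤ liminf (fun a : Fin M → ℝ =>
      (MSPRT.stoppingTime prior α η path a (fun i => X i ω) : ℝ≥0∞) /
        ENNReal.ofReal (-Real.log (a k))) F :=
    hlower.mono fun ω hω => MSPRT.le_liminf_div hL hω
  constructor
  · have hfin : ∀ᵐ ω ∂P, ∀ q : ℚ, 0 < q → ENNReal.ofReal q < D → ∃ C : ℝ, ∀ᶠ a in F,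
        (MSPRT.stoppingTime prior α η path a (fun i => X i ω) : ℝ≥0∞) ≤
          ENNReal.ofReal (-Real.log (a k) / q + C) := by
      rw [ae_all_iff]
      intro q
      by_cases hq : 0 < q ∧ ENNReal.ofReal q < D
      · obtain ⟨C, W, hWm, hW, hT⟩ := hupper q hq.1 hq.2
        filter_upwards [hT, ae_lt_top hWm hW] with ω hω hWω _ _
        obtain ⟨C', hC'⟩ := habsorb q C (W ω) hq.1 hWω.ne
        exact ⟨C', by filter_upwards [hC', hmemS] with a h1 h2 using
          (hω a h2.2 (h2.1 k).2).trans h1⟩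
      · exact Eventually.of_forall fun ω h1 h2 => absurd ⟨h1, h2⟩ hq
    filter_upwards [hfin, hliminf] with ω hω hω'
    exact tendsto_of_le_liminf_of_limsup_le hω' (MSPRT.limsup_div_le hL hω)
  · refine tendsto_of_le_liminf_of_limsup_le ?_ (MSPRT.limsup_div_le hL fun q hq0 hq => ?_)
    · have hmeas : ∀ a : Fin M → ℝ, Measurable fun ω =>
          (MSPRT.stoppingTime prior α η path a (fun i => X i ω) : ℝ≥0∞) :=
        fun a => MSPRT.measurable_stoppingTime hX.measurable
      calc 1 / D = ∫⁻ _, 1 / D ∂P := by simp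
        _ ≤ ∫⁻ ω, liminf (fun a : Fin M → ℝ =>
              (MSPRT.stoppingTime prior α η path a (fun i => X i ω) : ℝ≥0∞) /
                ENNReal.ofReal (-Real.log (a k))) F ∂P := lintegral_mono_ae hliminf
        _ ≤ liminf (fun a : Fin M → ℝ => ∫⁻ ω,
              (MSPRT.stoppingTime prior α η path a (fun i => X i ω) : ℝ≥0∞) /
                ENNReal.ofReal (-Real.log (a k)) ∂P) F :=
            lintegral_liminf_le fun a => (hmeas a).div_const _
        _ = _ := by
            congr 1
            ext a
            simp only [div_eq_mul_inv]
            exact lintegral_mul_const _ (hmeas a)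
    · obtain ⟨C, W, hWm, hW, hT⟩ := hupper q hq0 hq
      obtain ⟨C', hC'⟩ := habsorb q C (∫⁻ ω, W ω ∂P) hq0 hW
      refine ⟨C', ?_⟩
      filter_upwards [hC', hmemS] with a h1 h2
      refine le_trans ?_ h1
      calc ∫⁻ ω, (MSPRT.stoppingTime prior α η path a (fun i => X i ω) : ℝ≥0∞) ∂P
          ≤ ∫⁻ ω, (ENNReal.ofReal (-Real.log (a k) / q + C) + W ω) ∂P :=
            lintegral_mono_ae (hT.mono fun ω h => h a h2.2 (h2.1 k).2)
        _ = _ := by rw [lintegral_add_left measurable_const]; simp
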